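/- A binary tree is either a single leaf or an inner node with an ordered pair of binary trees as left and right subtrees; its size is its number of inner nodes. The register function is defined by $\operatorname{Reg}(t)=0$ if $t$ is a single leaf, and, if $t$ has subtrees $t_1,t_2$, by $\operatorname{Reg}(t)=\max\{\operatorname{Reg}(t_1),\operatorname{Reg}(t_2)\}$ if $\operatorname{Reg}(t_1)\ne\operatorname{Reg}(t_2)$ and $\operatorname{Reg}(t)=\operatorname{Reg}(t_1)+1$ otherwise. Label every node (inner node or leaf) of a binary tree by the value of the register function of the subtree rooted at it. For $r\ge 0$, an $r$-branch is a maximal chain of nodes labelled $r$, i.e. a connected component of the subgraph induced by the nodes with label $r$. Let $X_{n;r}$ be the number of $r$-branches of a uniformly random binary tree of size $n$, and let $X_n=\sum_{r\ge0}X_{n;r}$ be the total number of branches. Theorem. As $n\to\infty$, $$\mathbb{E}X_n=\frac{4n}{3}+\frac16\log_4 n-\frac{2\zeta'(-1)}{\log 2}-\frac{\gamma}{12\log 2}-\frac{1}{6\log 2}+\frac{43}{36}+\delta(\log_4 n)+O\Big(\frac{\log n}{n}\Big),$$ where $\zeta$ is the Riemann zeta function, $\gamma$ is the Euler--Mascheroni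 constant, and $$\delta(x)=\frac{1}{\log 2}\sum_{k\in\mathbb{Z}\setminus\{0\}}\Gamma\Big(\frac{\chi_k}{2}\Big)\zeta(\chi_k-1)(\chi_k-1)e^{2\pi i k x},\qquad \chi_k=\frac{2\pi i k}{\log 2}.$$ The Fourier series converges absolutely, and $\delta$ is a continuous, real-valued, $1$-periodic function with mean $\int_0^1\delta(x)\,dx=0$. -/

import Mathlib

namespace TreeBranches

open BinaryTree

/-- The register function (Horton–Strahler number) of a binary tree; `nil` is the tree that
consists of a single leaf. -/
def reg : BinaryTree Unit → ℕ
  | .nil => 0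
  | .node _ l r => if reg l = reg r then reg l + 1 else max (reg l) (reg r)

/-- The nodes of a binary tree, inner nodes as well as leaves. -/
inductive Node : BinaryTree Unit → Type
  | root (t : BinaryTree Unit) : Node t
  | left {a : Unit} {l r : BinaryTree Unit} (p : Node l) : Node (.node a l r)
  | right {a : Unit} {l r : BinaryTree Unit} (p : Node r) : Node (.node a l r)

/-- The subtree rooted at a node. -/
def Node.subtree : {t : BinaryTree Unit} → Node t → BinaryTree Unit
  | _, .root t => t
  | _, .left p => p.subtree
  | _, .right p => p.subtree

/-- The label of a node: the register function of the subtree rooted at it. -/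
def Node.label {t : BinaryTree Unit} (p : Node t) : ℕ := reg p.subtree

/-- `IsParent p q`: the node `q` is one of the two children of the inner node `p`. -/
inductive IsParent : {t : BinaryTree Unit} → Node t → Node t → Prop
  | root_left {a : Unit} {l r : BinaryTree Unit} :
      IsParent (Node.root (.node a l r)) (Node.left (Node.root l))
  | root_right {a : Unit} {l r : BinaryTree Unit} :
      IsParent (Node.root (.node a l r)) (Node.right (Node.root r))
  | left {a : Unit} {l r : BinaryTree Unit} {p q : Node l} (h : IsParent p q) :
      IsParent (Node.left p : Node (.node a l r)) (Node.left q)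
  | right {a : Unit} {l r : BinaryTree Unit} {p q : Node r} (h : IsParent p q) :
      IsParent (Node.right p : Node (.node a l r)) (Node.right q)

/-- A binary tree as an undirected graph on its nodes: the edges join parents and children. -/
def treeGraph (t : BinaryTree Unit) : SimpleGraph (Node t) := SimpleGraph.fromRel IsParent

/-- The `r`-branches of `t`: the connected components of the subgraph induced by the nodes with
label `r`, that is, the maximal chains of nodes labelled `r`. -/
abbrev Branch (t : BinaryTree Unit) (r : ℕ) : Type :=
  ((treeGraph t).induce {p : Node t | p.label = r}).ConnectedComponent

instance instFiniteNode (t : BinaryTree Unit) : Finite (Node t) := by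
  induction t with
  | nil =>
    refine Finite.of_surjective (fun _ : Unit => Node.root .nil) ?_
    intro p
    cases p
    exact ⟨(), rfl⟩
  | node a l r hl hr =>
    refine Finite.of_surjective (fun x : Unit ⊕ (Node l ⊕ Node r) =>
      match x with
      | .inl _ => Node.root (.node a l r)
      | .inr (.inl p) => Node.left p
      | .inr (.inr p) => Node.right p) ?_
    intro p
    cases p with
    | root => exact ⟨.inl (), rfl⟩
    | left p => exact ⟨.inr (.inl p), rfl⟩
    | right p => exact ⟨.inr (.inr p), rfl⟩

/-- The number of `r`-branches of `t` (a genuine cardinality, as `Node t` is finite). -/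
noncomputable def numBranches (t : BinaryTree Unit) (r : ℕ) : ℕ := Nat.card (Branch t r)

theorem Node.label_le_reg {t : BinaryTree Unit} (p : Node t) : p.label ≤ reg t := by
  induction p with
  | root t => exact le_rfl
  | @left a l r p ih =>
    have h : p.label ≤ reg (.node a l r) := by
      rw [reg]
      split_ifs <;> omega
    exact h
  | @right a l r p ih =>
    have h : p.label ≤ reg (.node a l r) := by
      rw [reg]
      split_ifs <;> omega
    exact h

/-- Only finitely many `r` contribute to the total number of branches. -/
theorem finite_support_numBranches (t : BinaryTree Unit) :
    (Function.support (numBranches t)).Finite := by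
  refine (Set.finite_Iic (reg t)).subset fun r hr => ?_
  obtain ⟨c⟩ := (Nat.card_ne_zero.mp hr).1
  obtain ⟨⟨p, hp⟩, -⟩ := c.exists_rep
  exact Set.mem_Iic.mpr (hp ▸ p.label_le_reg)

/-- The total number of branches of `t`, the sum of the numbers of `r`-branches over all `r ≥ 0`. -/
noncomputable def totalBranches (t : BinaryTree Unit) : ℕ := ∑ᶠ r : ℕ, numBranches t r

/-- The expected total number of branches of a binary tree that is uniformly distributed on the
finite set of all binary trees with `n` inner nodes. -/
noncomputable def expectedBranches (n : ℕ) : ℝ :=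
  (∑ t ∈ treesOfNumNodesEq n, (totalBranches t : ℝ)) / (treesOfNumNodesEq n).card

/-- `χ_k = 2πik / log 2`. -/
noncomputable def chi (k : ℤ) : ℂ := 2 * Real.pi * Complex.I * k / Real.log 2

/-- The coefficient of `e^{2πikx}` in the Fourier series of the fluctuation, for `k ≠ 0`. -/
noncomputable def deltaCoeff (k : ℤ) : ℂ :=
  1 / Real.log 2 * (Complex.Gamma (chi k / 2) * riemannZeta (chi k - 1) * (chi k - 1))

/-- The fluctuation `δ`, as the sum of its Fourier series over all integers `k ≠ 0`. -/
noncomputable def delta (x : ℝ) : ℂ :=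
  ∑' k : {k : ℤ // k ≠ 0}, deltaCoeff k * Complex.exp (2 * Real.pi * Complex.I * (k : ℤ) * x)

end TreeBranches

/-!
Counting branches by their topmost nodes shows that, for `r ≥ 1`, an `r`-branch arises exactly where
two sibling subtrees with register function `r - 1` meet. With `X = u / (1 + u) ^ 2` the generating
functions become rational in `u`, the trees with a given value of the register function being
controlled by Newton's iteration for `G = 1 + X G ^ 2`. Extracting coefficients expresses the
expected number of branches as a sum over `r` and `k` of `k` times a second difference of binomial
coefficients at distance `k 2 ^ r` from the centre.

Put `N = n + 1` and `M = N + 1 / 2`. The quotient of the binomial coefficient at distance `m` by the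
central one is the product over `j = 1, …, m` of `(1 - t) / (1 + t)` with `t = (2 j - 1) / (2 M)`,
hence close to `exp (-m ^ 2 / M)`. Up to a total error `O(1 / M)`, the sum over `k` is therefore
`F(4 ^ r / M) + G(4 ^ r / M) / M`, where `F` (`branchSum`) and `G` (`correctionSum`) are harmonic
sums of the form `∑ k p(k ^ 2 t) exp(-k ^ 2 t)`. By Euler–Maclaurin summation `F(t) = 1 / t + 1 / 6
+ O(t)` and `G(t) = -2 / (3 t) + O(t)` as `t → 0`, so that the second summand contributes the
constant `-8 / 9`. Extending the sum of `F(4 ^ r / M)` to all integers `r`, with the terms `1 / t +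
1 / 6` removed for `r ≤ 0`, costs `O(1 / M)` and produces a function of `log_4 M` that is
`1`-periodic apart from explicit elementary terms. Its Fourier coefficients are values of the Mellin
transform `(4 s - 2) Γ(s) ζ(2 s - 1)` of `F` at the points `χ_k / 2`, except that `k = 0` calls for
the finite part at the pole `s = 0`, which brings in `γ` and the derivative of `ζ` at `-1`.
-/

namespace TreeBranches

/-! ### Branches and their topmost nodes -/

section RootedForest

variable {α : Type*} {R : α → α → Prop}

theorem exists_common_ancestor_of_reachable (hR : Relator.LeftUnique R) {a b : α}
    (h : (SimpleGraph.fromRel R).Reachable a b) :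
    ∃ c, Relation.ReflTransGen R c a ∧ Relation.ReflTransGen R c b := by
  rw [SimpleGraph.reachable_iff_reflTransGen] at h
  induction h with
  | refl => exact ⟨a, .refl, .refl⟩
  | @tail b d _ hbd ih =>
    obtain ⟨c, hca, hcb⟩ := ih
    rcases hbd.2 with hbd | hdb
    · exact ⟨c, hca, hcb.tail hbd⟩
    · rcases hcb.cases_tail with rfl | ⟨d', hcd', hd'b⟩
      · exact ⟨d, hca.head hdb, .refl⟩
      · exact ⟨c, hca, hR hd'b hdb ▸ hcd'⟩

theorem reachable_fromRel_of_reflTransGen {a b : α} (h : Relation.ReflTransGen R a b) :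
    (SimpleGraph.fromRel R).Reachable a b := by
  induction h with
  | refl => exact .refl _
  | @tail b c _ hbc ih =>
    rcases eq_or_ne b c with rfl | hne
    · exact ih
    · exact ih.trans (SimpleGraph.Adj.reachable ⟨hne, .inl hbc⟩)

theorem exists_root_reflTransGen (hwf : WellFounded R) (a : α) :
    ∃ c, (∀ b, ¬ R b c) ∧ Relation.ReflTransGen R c a := by
  induction a using hwf.induction with
  | _ a ih =>
    by_cases ha : ∃ b, R b a
    · obtain ⟨b, hba⟩ := ha
      obtain ⟨c, hc, hcb⟩ := ih b hba
      exact ⟨c, hc, hcb.tail hba⟩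
    · exact ⟨a, not_exists.1 ha, .refl⟩

theorem card_connectedComponent_fromRel (hwf : WellFounded R) (hR : Relator.LeftUnique R) :
    Nat.card (SimpleGraph.fromRel R).ConnectedComponent = Nat.card {a : α // ∀ b, ¬ R b a} := by
  have eq_root {a c : α} (ha : ∀ b, ¬ R b a) (h : Relation.ReflTransGen R c a) : c = a :=
    (h.cases_tail).elim Eq.symm fun ⟨b, _, hba⟩ => absurd hba (ha b)
  refine (Nat.card_congr (Equiv.ofBijective (fun a : {a : α // ∀ b, ¬ R b a} =>
    (SimpleGraph.fromRel R).connectedComponentMk a.1) ⟨fun a b hab => ?_, fun c => ?_⟩)).symm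
  · obtain ⟨c, hca, hcb⟩ :=
      exists_common_ancestor_of_reachable hR (SimpleGraph.ConnectedComponent.exact hab)
    exact Subtype.ext ((eq_root a.2 hca).symm.trans (eq_root b.2 hcb))
  · obtain ⟨a, rfl⟩ := c.exists_rep
    obtain ⟨b, hb, hba⟩ := exists_root_reflTransGen hwf a
    exact ⟨⟨b, hb⟩, SimpleGraph.ConnectedComponent.sound (reachable_fromRel_of_reflTransGen hba)⟩

theorem induce_fromRel (s : Set α) :
    (SimpleGraph.fromRel R).induce s = SimpleGraph.fromRel fun a b : s => R a b := by
  ext a b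
  simp [SimpleGraph.fromRel_adj, Subtype.ext_iff]

end RootedForest

/-- The distance of a node from the root. -/
def Node.depth : {t : BinaryTree Unit} → Node t → ℕ
  | _, .root _ => 0
  | _, .left p => p.depth + 1
  | _, .right p => p.depth + 1

theorem IsParent.depth_eq {t : BinaryTree Unit} {p q : Node t} (h : IsParent p q) :
    q.depth = p.depth + 1 := by
  induction h with
  | root_left => rfl
  | root_right => rfl
  | left _ ih => exact congrArg (· + 1) ih
  | right _ ih => exact congrArg (· + 1) ih

theorem wellFounded_isParent (t : BinaryTree Unit) : WellFounded (IsParent (t := t)) :=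
  Subrelation.wf (r := InvImage (· < ·) Node.depth)
    (fun h => (Nat.lt_succ_self _).trans_eq h.depth_eq.symm) (InvImage.wf _ Nat.lt_wfRel.wf)

theorem leftUnique_isParent (t : BinaryTree Unit) : Relator.LeftUnique (IsParent (t := t)) := by
  intro p q s hps hqs
  induction hps with
  | root_left => cases hqs with
    | root_left => rfl
    | left h => cases h
  | root_right => cases hqs with
    | root_right => rfl
    | right h => cases h
  | left h ih => cases hqs with
    | root_left => cases h
    | left h' => exact congrArg Node.left (ih h')
  | right h ih => cases hqs with
    | root_right => cases h
    | right h' => exact congrArg Node.right (ih h')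

/-- A node is the topmost node of its branch if its parent, if any, has a different label. -/
def Node.IsTop {t : BinaryTree Unit} (p : Node t) : Prop := ∀ q, IsParent q p → q.label ≠ p.label

theorem numBranches_eq_card_isTop (t : BinaryTree Unit) (r : ℕ) :
    numBranches t r = Nat.card {p : Node t // p.IsTop ∧ p.label = r} := by
  have hwf : WellFounded fun p q : {p : Node t | p.label = r} => IsParent p.1 q.1 :=
    InvImage.wf _ (wellFounded_isParent t)
  rw [numBranches, Branch, treeGraph, induce_fromRel, card_connectedComponent_fromRel hwf
    fun p q s hp hq => Subtype.ext (leftUnique_isParent t hp hq)]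
  refine Nat.card_congr ((Equiv.subtypeSubtypeEquivSubtypeExists _ _).trans
    (Equiv.subtypeEquivRight fun p => ?_))
  constructor
  · rintro ⟨hp, h⟩
    exact ⟨fun q hqp hq => h ⟨q, hq.trans hp⟩ hqp, hp⟩
  · rintro ⟨h, hp⟩
    exact ⟨hp, fun q hqp => h q hqp (q.2.trans hp.symm)⟩

theorem Node.isTop_root (t : BinaryTree Unit) : (Node.root t).IsTop := by
  intro q h
  cases h

theorem Node.isTop_left {a : Unit} {l r : BinaryTree Unit} (p : Node l) :
    (Node.left p : Node (.node a l r)).IsTop ↔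
      p.IsTop ∧ ¬ (p = .root l ∧ reg l = reg (.node a l r)) := by
  constructor
  · refine fun h => ⟨fun q hqp => h (.left q) (.left hqp), ?_⟩
    rintro ⟨rfl, hl⟩
    exact h (.root _) .root_left hl.symm
  · rintro ⟨h, hroot⟩ q hqp
    cases hqp with
    | root_left => exact fun hl => hroot ⟨rfl, hl.symm⟩
    | left hqp => exact h _ hqp

theorem Node.isTop_right {a : Unit} {l r : BinaryTree Unit} (p : Node r) :
    (Node.right p : Node (.node a l r)).IsTop ↔
      p.IsTop ∧ ¬ (p = .root r ∧ reg r = reg (.node a l r)) := by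
  constructor
  · refine fun h => ⟨fun q hqp => h (.right q) (.right hqp), ?_⟩
    rintro ⟨rfl, hr⟩
    exact h (.root _) .root_right hr.symm
  · rintro ⟨h, hroot⟩ q hqp
    cases hqp with
    | root_right => exact fun hr => hroot ⟨rfl, hr.symm⟩
    | right hqp => exact h _ hqp

/-- A node of a tree is its root or a node of one of the two subtrees. -/
def nodeEquiv (a : Unit) (l r : BinaryTree Unit) :
    Unit ⊕ (Node l ⊕ Node r) ≃ Node (.node a l r) where
  toFun
    | .inl _ => .root (.node a l r)
    | .inr (.inl p) => .left p
    | .inr (.inr p) => .right p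
  invFun
    | .root _ => .inl ()
    | .left p => .inr (.inl p)
    | .right p => .inr (.inr p)
  left_inv := by rintro (_ | _ | _) <;> rfl
  right_inv := by intro p; cases p <;> rfl

noncomputable instance instFintypeNode (t : BinaryTree Unit) : Fintype (Node t) :=
  Fintype.ofFinite _

theorem sum_node {M : Type*} [AddCommMonoid M] (a : Unit) (l r : BinaryTree Unit)
    (f : Node (.node a l r) → M) :
    ∑ p, f p = f (.root _) + (∑ p, f (.left p) + ∑ p, f (.right p)) := by
  rw [← (nodeEquiv a l r).sum_comp, Fintype.sum_sum_type, Fintype.sum_sum_type]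
  simp [nodeEquiv]

open Classical in
theorem numBranches_eq_sum_isTop (t : BinaryTree Unit) (r : ℕ) :
    numBranches t r = ∑ p : Node t, if p.IsTop ∧ p.label = r then 1 else 0 := by
  rw [numBranches_eq_card_isTop, Nat.card_eq_fintype_card, Fintype.card_subtype,
    Finset.sum_boole, Nat.cast_id]

open Classical in
/-- Here `c` says that the root of `t` belongs to the branch of its parent in a larger tree. -/
theorem sum_isTop_and_not_root_add (t : BinaryTree Unit) (r : ℕ) (c : Prop) [Decidable c] :
    (∑ p : Node t, if (p.IsTop ∧ ¬ (p = .root t ∧ c)) ∧ p.label = r then 1 else 0) +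
      (if c ∧ reg t = r then 1 else 0) = numBranches t r := by
  have root_term : (if c ∧ reg t = r then 1 else 0) =
      ∑ p : Node t, if p = .root t ∧ c ∧ reg t = r then 1 else 0 := by
    rw [Fintype.sum_eq_single (Node.root t) fun p hp => if_neg fun h => hp h.1]
    simp only [true_and]
  rw [root_term, numBranches_eq_sum_isTop, ← Finset.sum_add_distrib]
  refine Finset.sum_congr rfl fun p _ => ?_
  by_cases hp : p = .root t
  · subst hp
    have label_root : (Node.root t).label = reg t := rfl
    by_cases hc : c <;> simp [hc, label_root, Node.isTop_root]
  · simp [hp]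

theorem numBranches_nil (r : ℕ) : numBranches .nil r = if r = 0 then 1 else 0 := by
  classical
  rw [numBranches_eq_sum_isTop, Fintype.sum_eq_single (Node.root .nil)]
  · simp [Node.isTop_root, Node.label, Node.subtree, reg, eq_comm]
  · intro p hp
    cases p
    exact absurd rfl hp

theorem numBranches_node (a : Unit) (l r : BinaryTree Unit) (k : ℕ) :
    numBranches (.node a l r) k =
      numBranches l k + numBranches r k + if reg l = reg r ∧ reg l + 1 = k then 1 else 0 := by
  classical
  have label_left (p : Node l) : (Node.left p : Node (.node a l r)).label = p.label := rfl
  have label_right (p : Node r) : (Node.right p : Node (.node a l r)).label = p.label := rfl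
  have label_root : (Node.root (.node a l r)).label = reg (.node a l r) := rfl
  have root_balance : (if reg (.node a l r) = k then 1 else 0) =
      (if reg l = reg (.node a l r) ∧ reg l = k then 1 else 0) +
      (if reg r = reg (.node a l r) ∧ reg r = k then 1 else 0) +
      if reg l = reg r ∧ reg l + 1 = k then 1 else 0 := by
    rw [reg]
    split_ifs <;> omega
  rw [← sum_isTop_and_not_root_add l k (reg l = reg (.node a l r)),
    ← sum_isTop_and_not_root_add r k (reg r = reg (.node a l r)), numBranches_eq_sum_isTop,
    sum_node]
  simp only [Node.isTop_left, Node.isTop_right, Node.isTop_root, label_left, label_right,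
    label_root, true_and, root_balance]
  omega

theorem reg_le_numNodes (t : BinaryTree Unit) : reg t ≤ t.numNodes := by
  induction t with
  | nil => simp [reg]
  | node a l r hl hr =>
    rw [reg, BinaryTree.numNodes]
    split_ifs <;> omega

theorem numBranches_eq_zero_of_reg_lt {t : BinaryTree Unit} {r : ℕ} (h : reg t < r) :
    numBranches t r = 0 := by
  rw [numBranches_eq_card_isTop]
  have : IsEmpty {p : Node t // p.IsTop ∧ p.label = r} :=
    ⟨fun p => absurd p.1.label_le_reg (by rw [p.2.2]; omega)⟩
  exact Nat.card_of_isEmpty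

theorem totalBranches_eq_sum_range {t : BinaryTree Unit} {n : ℕ} (h : t.numNodes ≤ n) :
    totalBranches t = ∑ r ∈ Finset.range (n + 1), numBranches t r := by
  refine finsum_eq_sum_of_support_subset _ fun r hr => ?_
  have : r ≤ reg t := not_lt.1 fun hlt => hr (numBranches_eq_zero_of_reg_lt hlt)
  have := reg_le_numNodes t
  simp only [Finset.coe_range, Set.mem_Iio]
  omega

open BinaryTree PowerSeries

/-! ### Generating functions -/

section TreeSeries

variable {R : Type*}

theorem sum_treesOfNumNodesEq_succ [AddCommMonoid R] (w : BinaryTree Unit → R) (n : ℕ) :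
    ∑ t ∈ treesOfNumNodesEq (n + 1), w t = ∑ ij ∈ Finset.HasAntidiagonal.antidiagonal n,
      ∑ l ∈ treesOfNumNodesEq ij.1, ∑ r ∈ treesOfNumNodesEq ij.2, w (.node () l r) := by
  rw [treesOfNumNodesEq_succ, Finset.sum_biUnion]
  · refine Finset.sum_congr rfl fun ij _ => ?_
    rw [Finset.sum_map, Finset.sum_product]
    rfl
  · simp_rw [Set.PairwiseDisjoint, Set.Pairwise, Finset.disjoint_left]
    aesop

/-- The generating function, with respect to the size, of a weight on binary trees. -/
noncomputable def treeSeries [Semiring R] (w : BinaryTree Unit → R) : PowerSeries R :=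
  mk fun n => ∑ t ∈ treesOfNumNodesEq n, w t

/-- The generating function, with respect to the size, of a weight on the trees that are not a
single leaf; the weight is given as a function of the two subtrees of the root. -/
noncomputable def nodeSeries [Semiring R] (v : BinaryTree Unit → BinaryTree Unit → R) :
    PowerSeries R :=
  X * mk fun n => ∑ ij ∈ Finset.HasAntidiagonal.antidiagonal n,
    ∑ l ∈ treesOfNumNodesEq ij.1, ∑ r ∈ treesOfNumNodesEq ij.2, v l r

theorem treeSeries_eq_C_add_nodeSeries [Semiring R] (w : BinaryTree Unit → R) :
    treeSeries w = C (w .nil) + nodeSeries fun l r => w (.node () l r) := by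
  ext n
  rcases n with _ | n
  · simp [treeSeries, nodeSeries]
  · rw [map_add, nodeSeries, coeff_succ_X_mul, coeff_succ_C, zero_add, treeSeries, coeff_mk,
      coeff_mk, sum_treesOfNumNodesEq_succ]

theorem nodeSeries_mul [Semiring R] (f g : BinaryTree Unit → R) :
    nodeSeries (fun l r => f l * g r) = X * (treeSeries f * treeSeries g) := by
  rw [nodeSeries]
  congr 1
  ext n
  simp only [coeff_mul, treeSeries, coeff_mk, Finset.sum_mul_sum]

theorem nodeSeries_add [Semiring R] (v w : BinaryTree Unit → BinaryTree Unit → R) :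
    nodeSeries (fun l r => v l r + w l r) = nodeSeries v + nodeSeries w := by
  simp only [nodeSeries, ← mul_add]
  congr 1
  ext n
  simp only [map_add, coeff_mk, Finset.sum_add_distrib]

theorem nodeSeries_sub [Ring R] (v w : BinaryTree Unit → BinaryTree Unit → R) :
    nodeSeries (fun l r => v l r - w l r) = nodeSeries v - nodeSeries w := by
  simp only [nodeSeries, ← mul_sub]
  congr 1
  ext n
  simp only [map_sub, coeff_mk, Finset.sum_sub_distrib]

end TreeSeries

/-- The generating function of all binary trees. -/
noncomputable def catSeries : PowerSeries ℝ := treeSeries fun _ => 1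

/-- The generating function of the binary trees with register function `r`. -/
noncomputable def regSeries (r : ℕ) : PowerSeries ℝ :=
  treeSeries fun t => if reg t = r then 1 else 0

/-- The generating function of the binary trees with register function less than `r`. -/
noncomputable def regLTSeries (r : ℕ) : PowerSeries ℝ :=
  treeSeries fun t => if reg t < r then 1 else 0

/-- The generating function of the number of `r`-branches. -/
noncomputable def branchSeries (r : ℕ) : PowerSeries ℝ :=
  treeSeries fun t => (numBranches t r : ℝ)

theorem catSeries_eq : catSeries = 1 + X * catSeries ^ 2 := by
  have h := nodeSeries_mul (fun _ => (1 : ℝ)) fun _ => 1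
  simp only [mul_one] at h
  rw [sq, catSeries, ← h]
  exact treeSeries_eq_C_add_nodeSeries _

theorem regLTSeries_zero : regLTSeries 0 = 0 := by
  ext n
  simp [regLTSeries, treeSeries]

theorem regSeries_eq_sub (r : ℕ) : regSeries r = regLTSeries (r + 1) - regLTSeries r := by
  ext n
  simp only [regSeries, regLTSeries, treeSeries, map_sub, coeff_mk, ← Finset.sum_sub_distrib]
  refine Finset.sum_congr rfl fun t _ => ?_
  split_ifs <;> first | omega | norm_num

theorem regLTSeries_succ (r : ℕ) : regLTSeries (r + 1) =
    1 + X * (2 * regLTSeries (r + 1) * regLTSeries r - regLTSeries r ^ 2) := by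
  set a : ℕ → BinaryTree Unit → ℝ := fun r t => if reg t < r then 1 else 0
  have weight_node (s t : BinaryTree Unit) : a (r + 1) (.node () s t) =
      a (r + 1) s * a r t + a r s * a (r + 1) t - a r s * a r t := by
    simp only [a, reg]
    split_ifs <;> first | omega | norm_num
  have h := treeSeries_eq_C_add_nodeSeries (a (r + 1))
  simp only [weight_node, nodeSeries_sub, nodeSeries_add, nodeSeries_mul] at h
  have weight_nil : a (r + 1) .nil = 1 := if_pos (Nat.succ_pos r)
  rw [weight_nil, map_one] at h
  simp only [regLTSeries]
  linear_combination h

theorem branchSeries_zero : branchSeries 0 = 1 + X * (2 * catSeries * branchSeries 0) := by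
  have h := treeSeries_eq_C_add_nodeSeries fun t => (numBranches t 0 : ℝ)
  have weight_node (s t : BinaryTree Unit) : (numBranches (.node () s t) 0 : ℝ) =
      numBranches s 0 * 1 + 1 * numBranches t 0 := by
    simp [numBranches_node]
  simp only [weight_node, nodeSeries_add, nodeSeries_mul (fun t => (numBranches t 0 : ℝ)),
    nodeSeries_mul (fun _ => (1 : ℝ)), numBranches_nil, if_true, Nat.cast_one, map_one] at h
  rw [branchSeries, catSeries]
  linear_combination h

theorem branchSeries_succ (r : ℕ) : branchSeries (r + 1) =
    X * (2 * catSeries * branchSeries (r + 1) + regSeries r ^ 2) := by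
  set e : BinaryTree Unit → ℝ := fun t => if reg t = r then 1 else 0 with he
  set b : BinaryTree Unit → ℝ := fun t => numBranches t (r + 1) with hb
  have weight_node (s t : BinaryTree Unit) :
      b (.node () s t) = b s * 1 + 1 * b t + e s * e t := by
    simp only [b, e, numBranches_node, Nat.cast_add, Nat.cast_ite]
    split_ifs <;> first | omega | norm_num
  have weight_nil : b .nil = 0 := by simp [b, numBranches_nil]
  have h := treeSeries_eq_C_add_nodeSeries b
  simp only [weight_node, nodeSeries_add, nodeSeries_mul b, nodeSeries_mul e,
    nodeSeries_mul (fun _ => (1 : ℝ)), weight_nil, map_zero] at h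
  simp only [branchSeries, catSeries, regSeries, ← he, ← hb]
  linear_combination h

/-- The series `u` with `X = u / (1 + u) ^ 2`. -/
noncomputable def uSeries : PowerSeries ℝ := catSeries - 1

theorem catSeries_eq_one_add : catSeries = 1 + uSeries := by rw [uSeries]; ring

theorem X_mul_catSeries_sq : X * catSeries ^ 2 = uSeries := by
  rw [uSeries]; linear_combination -catSeries_eq

theorem constantCoeff_uSeries : constantCoeff uSeries = 0 := by
  rw [← X_mul_catSeries_sq]; simp

theorem catSeries_ne_zero : catSeries ≠ 0 := by
  intro h
  have := congrArg constantCoeff catSeries_eq_one_add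
  rw [h] at this
  simp [constantCoeff_uSeries] at this

theorem uSeries_ne_zero : uSeries ≠ 0 := by
  rw [← X_mul_catSeries_sq]
  exact mul_ne_zero X_ne_zero (pow_ne_zero _ catSeries_ne_zero)

theorem one_sub_uSeries_pow_ne_zero {m : ℕ} (hm : m ≠ 0) : 1 - uSeries ^ m ≠ 0 := by
  intro h
  have := congrArg constantCoeff h
  simp [constantCoeff_uSeries, hm] at this

theorem uSeries_pow_two_pow_succ (r : ℕ) : uSeries ^ 2 ^ (r + 1) = (uSeries ^ 2 ^ r) ^ 2 := by
  rw [← pow_mul, pow_succ 2]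

theorem one_sub_two_mul_X_mul_ne_zero (g : PowerSeries ℝ) : 1 - 2 * X * g ≠ 0 := by
  intro h
  have := congrArg constantCoeff h
  simp at this

/-- The recursion `regLTSeries_succ` is Newton's iteration for the quadratic equation
`G = 1 + X * G ^ 2` with roots `catSeries` and `catSeries / uSeries`, so one step squares the ratio
of the distances to the two roots, which is `uSeries` initially. -/
theorem uSeries_mul_catSeries_sub_regLTSeries (r : ℕ) :
    uSeries * (catSeries - regLTSeries r) =
      uSeries ^ 2 ^ r * (catSeries - uSeries * regLTSeries r) := by
  induction r with
  | zero => simp [regLTSeries_zero]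
  | succ r ih =>
    apply mul_left_cancel₀ (mul_ne_zero uSeries_ne_zero
      (one_sub_two_mul_X_mul_ne_zero (regLTSeries r)))
    have distance_sq : (1 - 2 * X * regLTSeries r) * (catSeries - regLTSeries (r + 1)) =
        X * (catSeries - regLTSeries r) ^ 2 := by
      linear_combination catSeries_eq - regLTSeries_succ r
    have distance_conj_sq : uSeries * ((1 - 2 * X * regLTSeries r) *
        (catSeries - uSeries * regLTSeries (r + 1))) =
          X * (catSeries - uSeries * regLTSeries r) ^ 2 := by
      linear_combination uSeries * catSeries_eq_one_add - X_mul_catSeries_sq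
        - uSeries ^ 2 * regLTSeries_succ r
    rw [uSeries_pow_two_pow_succ]
    generalize uSeries ^ 2 ^ r = x at ih ⊢
    linear_combination uSeries ^ 2 * distance_sq - x ^ 2 * distance_conj_sq
      + X * (uSeries * (catSeries - regLTSeries r) +
          x * (catSeries - uSeries * regLTSeries r)) * ih

theorem regSeries_mul (r : ℕ) :
    regSeries r * (1 - uSeries ^ 2 ^ (r + 1)) * uSeries = (1 - uSeries ^ 2) * uSeries ^ 2 ^ r := by
  have h := uSeries_mul_catSeries_sub_regLTSeries r
  have h' := uSeries_mul_catSeries_sub_regLTSeries (r + 1)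
  have hx : 1 - uSeries ^ 2 ^ r ≠ 0 := one_sub_uSeries_pow_ne_zero (by positivity)
  rw [uSeries_pow_two_pow_succ] at h' ⊢
  apply mul_left_cancel₀ hx
  rw [regSeries_eq_sub]
  generalize uSeries ^ 2 ^ r = x at *
  linear_combination (1 - x ^ 2) * h - (1 - x) * h'
    + (x * (1 - x) * (1 - uSeries)) * catSeries_eq_one_add

/-- The series `1 / √(1 - 4 X)`. -/
noncomputable def rootSeries : PowerSeries ℝ := (1 - 2 * X * catSeries)⁻¹

theorem rootSeries_mul : rootSeries * (1 - 2 * X * catSeries) = 1 :=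
  PowerSeries.inv_mul_cancel _ (by simp)

theorem branchSeries_mul (r : ℕ) : branchSeries r * (1 - uSeries ^ 2 ^ r) ^ 2 =
    rootSeries * (1 - uSeries) ^ 2 * uSeries ^ (2 ^ r - 1) := by
  apply mul_right_cancel₀ uSeries_ne_zero
  rw [mul_assoc _ (uSeries ^ _), ← pow_succ, Nat.sub_add_cancel Nat.one_le_two_pow]
  rcases r with _ | r
  · rw [pow_zero, pow_one]
    linear_combination (1 - uSeries) ^ 2 * uSeries *
      (rootSeries * branchSeries_zero - branchSeries 0 * rootSeries_mul)
  · have h := regSeries_mul r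
    have branch_eq : branchSeries (r + 1) = rootSeries * X * regSeries r ^ 2 := by
      linear_combination rootSeries * branchSeries_succ r - branchSeries (r + 1) * rootSeries_mul
    apply mul_left_cancel₀ (pow_ne_zero 2 catSeries_ne_zero)
    rw [branch_eq]
    rw [uSeries_pow_two_pow_succ] at h ⊢
    generalize uSeries ^ 2 ^ r = x at *
    linear_combination rootSeries * uSeries * (1 - x ^ 2) ^ 2 * regSeries r ^ 2 * X_mul_catSeries_sq
      + rootSeries * (regSeries r * (1 - x ^ 2) * uSeries + (1 - uSeries ^ 2) * x) * h
      - rootSeries * (1 - uSeries) ^ 2 * x ^ 2 * (catSeries + 1 + uSeries) * catSeries_eq_one_add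

/-! ### Coefficients of the generating functions -/

theorem rootSeries_eq : rootSeries = 1 + X * (C 2 * rootSeries + C 2 * (rootSeries * uSeries)) := by
  rw [map_ofNat]
  linear_combination rootSeries_mul + 2 * X * rootSeries * catSeries_eq_one_add

theorem rootSeries_mul_uSeries_pow_succ (m : ℕ) : rootSeries * uSeries ^ (m + 1) =
    X * (rootSeries * uSeries ^ (m + 2) + C 2 * (rootSeries * uSeries ^ (m + 1)) +
      rootSeries * uSeries ^ m) := by
  have h := X_mul_catSeries_sq
  rw [catSeries_eq_one_add] at h
  rw [map_ofNat]
  linear_combination -rootSeries * uSeries ^ m * h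

theorem choose_two_mul_succ (n m : ℕ) : (2 * (n + 1)).choose (n + 1 + (m + 1)) =
    (2 * n).choose (n + m) + 2 * (2 * n).choose (n + (m + 1)) + (2 * n).choose (n + (m + 2)) := by
  rw [show 2 * (n + 1) = 2 * n + 1 + 1 by ring, show n + 1 + (m + 1) = n + m + 1 + 1 by ring,
    Nat.choose_succ_succ', Nat.choose_succ_succ' (2 * n), Nat.choose_succ_succ' (2 * n)]
  ring_nf

theorem coeff_rootSeries_mul_pow (n m : ℕ) :
    coeff n (rootSeries * uSeries ^ m) = ((2 * n).choose (n + m) : ℝ) := by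
  induction n generalizing m with
  | zero =>
    have constantCoeff_rootSeries : constantCoeff rootSeries = 1 := by
      simpa using congrArg constantCoeff rootSeries_eq
    rcases m with _ | m
    · simp [constantCoeff_rootSeries]
    · simp [constantCoeff_uSeries]
  | succ n ih =>
    have ih_zero : coeff n rootSeries = ((2 * n).choose n : ℝ) := by simpa using ih 0
    have ih_one : coeff n (rootSeries * uSeries) = ((2 * n).choose (n + 1) : ℝ) := by
      simpa using ih 1
    rcases m with _ | m
    · rw [pow_zero, mul_one, rootSeries_eq, map_add, coeff_succ_X_mul, coeff_one,
        if_neg (Nat.succ_ne_zero n), map_add, coeff_C_mul, coeff_C_mul, ih_zero, ih_one, add_zero,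
        show 2 * (n + 1) = 2 * n + 1 + 1 by ring, Nat.choose_succ_succ',
        Nat.choose_symm_of_eq_add (show 2 * n + 1 = n + (n + 1) by ring),
        Nat.choose_succ_succ' (2 * n) n]
      push_cast
      ring
    · rw [rootSeries_mul_uSeries_pow_succ, coeff_succ_X_mul, map_add, map_add, coeff_C_mul, ih, ih,
        ih, choose_two_mul_succ]
      push_cast
      ring

theorem one_sub_sq_mul_sum {R : Type*} [CommRing R] (x : R) (K : ℕ) :
    (1 - x) ^ 2 * ∑ k ∈ Finset.range K, ((k : R) + 1) * x ^ k =
      1 - x ^ K * ((K : R) + 1 - K * x) := by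
  induction K with
  | zero => simp
  | succ K ih =>
    rw [Finset.sum_range_succ, mul_add, ih]
    push_cast
    ring

theorem branchSeries_eq_sum_add (K r : ℕ) :
    branchSeries r = ∑ k ∈ Finset.range K, C ((k : ℝ) + 1) *
      (rootSeries * uSeries ^ ((k + 1) * 2 ^ r - 1) -
        C 2 * (rootSeries * uSeries ^ ((k + 1) * 2 ^ r)) +
        rootSeries * uSeries ^ ((k + 1) * 2 ^ r + 1)) +
      (uSeries ^ 2 ^ r) ^ K *
        (branchSeries r * ((K : PowerSeries ℝ) + 1 - K * uSeries ^ 2 ^ r)) := by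
  have sum_eq : ∑ k ∈ Finset.range K, C ((k : ℝ) + 1) *
      (rootSeries * uSeries ^ ((k + 1) * 2 ^ r - 1) -
        C 2 * (rootSeries * uSeries ^ ((k + 1) * 2 ^ r)) +
        rootSeries * uSeries ^ ((k + 1) * 2 ^ r + 1)) =
      branchSeries r * ((1 - uSeries ^ 2 ^ r) ^ 2 *
        ∑ k ∈ Finset.range K, ((k : PowerSeries ℝ) + 1) * (uSeries ^ 2 ^ r) ^ k) := by
    rw [← mul_assoc, branchSeries_mul, Finset.mul_sum]
    refine Finset.sum_congr rfl fun k _ => ?_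
    have exponent_eq : (k + 1) * 2 ^ r = (2 ^ r - 1) + 2 ^ r * k + 1 := by
      have := Nat.one_le_two_pow (n := r)
      rw [add_mul, mul_comm k]; omega
    rw [exponent_eq, Nat.add_sub_cancel]
    simp only [map_add, map_natCast, map_one, map_ofNat]
    rw [pow_succ _ (_ + 1), pow_succ, pow_add, pow_mul]
    ring
  rw [sum_eq, one_sub_sq_mul_sum]
  ring

theorem coeff_branchSeries {n K : ℕ} (h : n < K) (r : ℕ) :
    coeff n (branchSeries r) = ∑ k ∈ Finset.range K, ((k : ℝ) + 1) *
      (((2 * n).choose (n + ((k + 1) * 2 ^ r - 1)) : ℝ) - 2 * (2 * n).choose (n + (k + 1) * 2 ^ r) +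
        (2 * n).choose (n + ((k + 1) * 2 ^ r + 1))) := by
  have remainder_dvd : (X : PowerSeries ℝ) ^ K ∣ (uSeries ^ 2 ^ r) ^ K *
      (branchSeries r * ((K : PowerSeries ℝ) + 1 - K * uSeries ^ 2 ^ r)) :=
    ((pow_dvd_pow_of_dvd (dvd_pow (X_dvd_iff.2 constantCoeff_uSeries) (by positivity)) _)).mul_right
      _
  rw [branchSeries_eq_sum_add K, map_add, X_pow_dvd_iff.1 remainder_dvd n h, add_zero, map_sum]
  refine Finset.sum_congr rfl fun k _ => ?_
  rw [coeff_C_mul, map_add, map_sub, coeff_C_mul, coeff_rootSeries_mul_pow,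
    coeff_rootSeries_mul_pow, coeff_rootSeries_mul_pow]

theorem sum_totalBranches (n : ℕ) : ∑ t ∈ treesOfNumNodesEq n, (totalBranches t : ℝ) =
    ∑ r ∈ Finset.range (n + 1), coeff n (branchSeries r) := by
  simp only [branchSeries, treeSeries, coeff_mk]
  rw [Finset.sum_comm]
  refine Finset.sum_congr rfl fun t ht => ?_
  rw [totalBranches_eq_sum_range (mem_treesOfNumNodesEq.1 ht).le, Nat.cast_sum]

/-! ### The expected number of branches as a sum over binomial coefficients -/

/-- The binomial coefficient at distance `m` from the centre, divided by the central one. -/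
noncomputable def relChoose (N m : ℕ) : ℝ := ((2 * N).choose (N + m) : ℝ) / (2 * N).choose N

/-- A second difference of binomial coefficients, divided by a Catalan number (see
`branchWeight_mul_catalan`): the average number of branches of a tree with `N - 1` inner nodes is a
linear combination of these weights. -/
noncomputable def branchWeight (N m : ℕ) : ℝ := (4 * (m : ℝ) ^ 2 / N - 2) * relChoose N m

theorem relChoose_eq_zero {N m : ℕ} (h : N < m) : relChoose N m = 0 := by
  rw [relChoose, Nat.choose_eq_zero_of_lt (by omega), Nat.cast_zero, zero_div]

theorem branchWeight_eq_zero {N m : ℕ} (h : N < m) : branchWeight N m = 0 := by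
  rw [branchWeight, relChoose_eq_zero h, mul_zero]

theorem choose_mul_eq (n m : ℕ) :
    ((2 * n).choose (n + m) : ℝ) * ((2 * n + 2) * (2 * n + 1)) =
      ((2 * (n + 1)).choose (n + 1 + m) : ℝ) * (((n : ℝ) + 1) ^ 2 - m ^ 2) := by
  rcases le_or_gt m (n + 1) with h | h
  · have raise_lower : ((2 * n + 1 : ℝ) + 1) * ((2 * n + 1).choose (n + m) : ℝ) =
        ((2 * n + 1 + 1).choose (n + m + 1) : ℝ) * (n + m + 1) := by
      exact_mod_cast Nat.add_one_mul_choose_eq (2 * n + 1) (n + m)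
    have raise_upper : ((2 * n).choose (n + m) : ℝ) * (2 * n + 1) =
        ((2 * n + 1).choose (n + m) : ℝ) * ((n : ℝ) + 1 - m) := by
      have cast_sub : ((2 * n + 1 - (n + m) : ℕ) : ℝ) = (n : ℝ) + 1 - m := by
        rw [show 2 * n + 1 - (n + m) = n + 1 - m by omega]
        push_cast [h]; ring
      rw [← cast_sub]
      exact_mod_cast Nat.choose_mul_succ_eq (2 * n) (n + m)
    rw [show 2 * (n + 1) = 2 * n + 1 + 1 by ring, show n + 1 + m = n + m + 1 by ring]
    linear_combination (2 * n + 2 : ℝ) * raise_upper + ((n : ℝ) + 1 - m) * raise_lower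
  · rw [Nat.choose_eq_zero_of_lt (by omega), Nat.choose_eq_zero_of_lt (by omega)]
    simp

theorem catalan_eq_choose_div (n : ℕ) :
    (catalan n : ℝ) = ((2 * (n + 1)).choose (n + 1) : ℝ) / (2 * (2 * n + 1)) := by
  have h : ((n : ℝ) + 1) * catalan n = (2 * n).choose n := by
    exact_mod_cast succ_mul_catalan_eq_centralBinom n
  have h' : ((n : ℝ) + 1) * (2 * (n + 1)).choose (n + 1) = 2 * (2 * n + 1) * (2 * n).choose n := by
    exact_mod_cast Nat.succ_mul_centralBinom_succ n
  have hn : (n : ℝ) + 1 ≠ 0 := by positivity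
  field_simp
  apply mul_left_cancel₀ hn
  linear_combination (2 * (2 * n + 1) : ℝ) * h - h'

theorem branchWeight_mul_catalan (n m : ℕ) :
    branchWeight (n + 1) (m + 1) * catalan n =
      ((2 * n).choose (n + m) : ℝ) - 2 * (2 * n).choose (n + (m + 1)) +
        (2 * n).choose (n + (m + 2)) := by
  have second_difference : ((2 * n).choose (n + m) : ℝ) - 2 * (2 * n).choose (n + (m + 1)) +
      (2 * n).choose (n + (m + 2)) =
        (2 * (n + 1)).choose (n + 1 + (m + 1)) - 4 * (2 * n).choose (n + (m + 1)) := by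
    rw [choose_two_mul_succ]
    push_cast
    ring
  have centre_eq : ((2 * n).choose (n + (m + 1)) : ℝ) =
      ((2 * (n + 1)).choose (n + 1 + (m + 1)) : ℝ) *
        (((n : ℝ) + 1) ^ 2 - (m + 1) ^ 2) / ((2 * n + 2) * (2 * n + 1)) := by
    rw [eq_div_iff (by positivity)]
    simpa using choose_mul_eq n (m + 1)
  have central_ne_zero : ((2 * (n + 1)).choose (n + 1) : ℝ) ≠ 0 := by
    exact_mod_cast (Nat.choose_pos (by omega)).ne'
  rw [second_difference, centre_eq, catalan_eq_choose_div, branchWeight, relChoose]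
  push_cast
  field_simp
  ring

theorem expectedBranches_eq_sum (n : ℕ) : expectedBranches n = ∑ r ∈ Finset.range (n + 1),
    ∑ k ∈ Finset.range (n + 1), ((k : ℝ) + 1) * branchWeight (n + 1) ((k + 1) * 2 ^ r) := by
  have catalan_ne_zero : (catalan n : ℝ) ≠ 0 := by
    rw [catalan_eq_choose_div]
    exact div_ne_zero (by exact_mod_cast (Nat.choose_pos (by omega)).ne') (by positivity)
  rw [expectedBranches, treesOfNumNodesEq_card_eq_catalan, div_eq_iff catalan_ne_zero,
    sum_totalBranches, Finset.sum_mul]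
  refine Finset.sum_congr rfl fun r _ => ?_
  rw [coeff_branchSeries n.lt_succ_self, Finset.sum_mul]
  refine Finset.sum_congr rfl fun k _ => ?_
  obtain ⟨m, hm⟩ : ∃ m, (k + 1) * 2 ^ r = m + 1 := Nat.exists_eq_succ_of_ne_zero (by positivity)
  rw [mul_assoc, hm, branchWeight_mul_catalan, Nat.add_sub_cancel]

theorem expectedBranches_eq_tsum (n : ℕ) : expectedBranches n =
    ∑' r : ℕ, ∑' k : ℕ, ((k : ℝ) + 1) * branchWeight (n + 1) ((k + 1) * 2 ^ r) := by
  have inner_sum (r : ℕ) : ∑' k : ℕ, ((k : ℝ) + 1) * branchWeight (n + 1) ((k + 1) * 2 ^ r) =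
      ∑ k ∈ Finset.range (n + 1), ((k : ℝ) + 1) * branchWeight (n + 1) ((k + 1) * 2 ^ r) := by
    refine tsum_eq_sum fun k hk => ?_
    rw [branchWeight_eq_zero, mul_zero]
    calc n + 1 < k + 1 := by simpa using hk
      _ ≤ (k + 1) * 2 ^ r := Nat.le_mul_of_pos_right _ (by positivity)
  simp_rw [inner_sum]
  rw [expectedBranches_eq_sum]
  refine (tsum_eq_sum fun r hr => Finset.sum_eq_zero fun k _ => ?_).symm
  rw [branchWeight_eq_zero, mul_zero]
  calc n + 1 ≤ r := by simpa using hr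
    _ < 2 ^ r := Nat.lt_two_pow_self
    _ ≤ (k + 1) * 2 ^ r := Nat.le_mul_of_pos_left _ k.succ_pos

/-! ### Gaussian approximation of binomial coefficients -/

theorem le_log_one_add_sub_log_one_sub {t : ℝ} (ht : 0 ≤ t) (ht1 : t < 1) :
    2 * (t + t ^ 3 / 3) ≤ Real.log (1 + t) - Real.log (1 - t) := by
  have series := Real.hasSum_log_sub_log_of_abs_lt_one (x := t) (by rwa [abs_of_nonneg ht])
  have partial_sum_le := sum_le_hasSum (Finset.range 2) (fun i _ => by positivity) series
  norm_num [Finset.sum_range_succ] at partial_sum_le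
  linarith

theorem log_one_add_sub_log_one_sub_le {t : ℝ} (ht : 0 ≤ t) (ht2 : t ≤ 1 / 2) :
    Real.log (1 + t) - Real.log (1 - t) ≤ 2 * (t + t ^ 3 / 3 + t ^ 5) := by
  have series := Real.hasSum_log_sub_log_of_abs_lt_one (x := t)
    (by rw [abs_of_nonneg ht]; linarith)
  have sq_le : t ^ 2 ≤ 1 / 4 := by nlinarith
  have geometric : HasSum (fun n : ℕ => t ^ 5 * (1 / 4 : ℝ) ^ n) (t ^ 5 * (1 - 1 / 4)⁻¹) :=
    (hasSum_geometric_of_lt_one (by norm_num) (by norm_num)).mul_left _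
  have tail_le := hasSum_le (fun n => ?_) ((hasSum_nat_add_iff' 2).2 series) geometric
  · norm_num [Finset.sum_range_succ] at tail_le
    have : 0 ≤ t ^ 5 := by positivity
    linarith
  · have coeff_le : 2 * (1 / (2 * ((n + 2 : ℕ) : ℝ) + 1)) ≤ 1 := by
      rw [← mul_div_assoc, div_le_one (by positivity)]
      push_cast
      linarith [n.cast_nonneg (α := ℝ)]
    calc 2 * (1 / (2 * ((n + 2 : ℕ) : ℝ) + 1)) * t ^ (2 * (n + 2) + 1)
        = 2 * (1 / (2 * ((n + 2 : ℕ) : ℝ) + 1)) * (t ^ 5 * (t ^ 2) ^ n) := by ring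
      _ ≤ 1 * (t ^ 5 * (1 / 4) ^ n) := by gcongr
      _ = t ^ 5 * (1 / 4) ^ n := one_mul _

theorem relChoose_zero (N : ℕ) : relChoose N 0 = 1 := by
  rw [relChoose, add_zero, div_self]
  exact_mod_cast (Nat.choose_pos (by omega)).ne'

theorem relChoose_succ (N m : ℕ) :
    relChoose N (m + 1) = relChoose N m * (((N : ℝ) - m) / (N + m + 1)) := by
  rcases le_or_gt m N with h | h
  · have choose_succ : ((2 * N).choose (N + m + 1) : ℝ) * (N + m + 1) =
        (2 * N).choose (N + m) * ((N : ℝ) - m) := by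
      have := Nat.choose_succ_right_eq (2 * N) (N + m)
      rw [show 2 * N - (N + m) = N - m by omega] at this
      rw [← Nat.cast_sub h]
      exact_mod_cast this
    rw [relChoose, relChoose, ← add_assoc, eq_div_of_mul_eq (by positivity) choose_succ]
    ring
  · rw [relChoose_eq_zero h, relChoose_eq_zero (by omega), zero_mul]

theorem relChoose_nonneg (N m : ℕ) : 0 ≤ relChoose N m := by
  rw [relChoose]
  positivity

theorem relChoose_pos {N m : ℕ} (h : m ≤ N) : 0 < relChoose N m :=
  div_pos (by exact_mod_cast Nat.choose_pos (by omega))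
    (by exact_mod_cast Nat.choose_pos (by omega))

theorem log_relChoose_succ {N m : ℕ} (h : m + 1 ≤ N) :
    Real.log (relChoose N (m + 1)) = Real.log (relChoose N m) -
      (Real.log (1 + ((m : ℝ) + 1 / 2) / (N + 1 / 2)) -
        Real.log (1 - ((m : ℝ) + 1 / 2) / (N + 1 / 2))) := by
  have h_cast : (m : ℝ) + 1 ≤ N := by exact_mod_cast h
  have add_eq : 1 + ((m : ℝ) + 1 / 2) / (N + 1 / 2) = ((N : ℝ) + m + 1) / (N + 1 / 2) := by
    field_simp
    ring
  have sub_eq : 1 - ((m : ℝ) + 1 / 2) / (N + 1 / 2) = ((N : ℝ) - m) / (N + 1 / 2) := by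
    field_simp
    ring
  have sub_pos : (0 : ℝ) < N - m := by linarith
  rw [add_eq, sub_eq, relChoose_succ, Real.log_mul (relChoose_pos (by omega)).ne' (by positivity),
    Real.log_div sub_pos.ne' (by positivity), Real.log_div (by positivity) (by positivity),
    Real.log_div sub_pos.ne' (by positivity)]
  ring

/-- Summing the increments `log_relChoose_succ` to third order; the right-hand side is the closed
form of the resulting polynomial sum. -/
theorem log_relChoose_le {N m : ℕ} (h : m ≤ N) :
    Real.log (relChoose N m) ≤ -((m : ℝ) ^ 2 / (N + 1 / 2)) -
      ((m : ℝ) ^ 4 / 6 - (m : ℝ) ^ 2 / 12) / ((N : ℝ) + 1 / 2) ^ 3 := by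
  induction m with
  | zero => simp [relChoose_zero]
  | succ m ih =>
    have ih := ih (by omega)
    have h_cast : (m : ℝ) + 1 ≤ N := by exact_mod_cast h
    have hM : (0 : ℝ) < N + 1 / 2 := by positivity
    have increment := le_log_one_add_sub_log_one_sub (t := ((m : ℝ) + 1 / 2) / (N + 1 / 2))
      (by positivity) (by rw [div_lt_one hM]; linarith)
    have telescope : -(((m : ℝ) + 1) ^ 2 / (N + 1 / 2)) -
        (((m : ℝ) + 1) ^ 4 / 6 - ((m : ℝ) + 1) ^ 2 / 12) / ((N : ℝ) + 1 / 2) ^ 3 =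
      -((m : ℝ) ^ 2 / (N + 1 / 2)) -
        ((m : ℝ) ^ 4 / 6 - (m : ℝ) ^ 2 / 12) / ((N : ℝ) + 1 / 2) ^ 3 -
        2 * (((m : ℝ) + 1 / 2) / (N + 1 / 2) + (((m : ℝ) + 1 / 2) / (N + 1 / 2)) ^ 3 / 3) := by
      field_simp
      ring
    rw [log_relChoose_succ h]
    push_cast
    linarith

theorem le_log_relChoose {N m : ℕ} (h : (m : ℝ) ≤ ((N : ℝ) + 1 / 2) / 2) :
    -((m : ℝ) ^ 2 / (N + 1 / 2)) -
      ((m : ℝ) ^ 4 / 6 - (m : ℝ) ^ 2 / 12) / ((N : ℝ) + 1 / 2) ^ 3 -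
        2 * (m : ℝ) ^ 6 / ((N : ℝ) + 1 / 2) ^ 5 ≤ Real.log (relChoose N m) := by
  induction m with
  | zero => simp [relChoose_zero]
  | succ m ih =>
    push_cast at h
    have ih := ih (by linarith)
    have hM : (0 : ℝ) < N + 1 / 2 := by positivity
    have m_lt : m < N := by
      have : (m : ℝ) < N := by linarith [m.cast_nonneg (α := ℝ)]
      exact_mod_cast this
    have increment := log_one_add_sub_log_one_sub_le (t := ((m : ℝ) + 1 / 2) / (N + 1 / 2))
      (by positivity) (by rw [div_le_iff₀ hM]; linarith)
    have pow_add_pow_le : (m : ℝ) ^ 6 + (m + 1 / 2) ^ 5 ≤ ((m : ℝ) + 1) ^ 6 := by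
      have : 0 ≤ ((m : ℝ) + 1) ^ 6 - (m : ℝ) ^ 6 - (m + 1 / 2) ^ 5 := by
        ring_nf
        positivity
      linarith
    have error_le : 2 * ((m : ℝ) ^ 6 + (m + 1 / 2) ^ 5) / ((N : ℝ) + 1 / 2) ^ 5 ≤
        2 * ((m : ℝ) + 1) ^ 6 / ((N : ℝ) + 1 / 2) ^ 5 := by gcongr
    have telescope : -(((m : ℝ) + 1) ^ 2 / (N + 1 / 2)) -
        (((m : ℝ) + 1) ^ 4 / 6 - ((m : ℝ) + 1) ^ 2 / 12) / ((N : ℝ) + 1 / 2) ^ 3 -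
        2 * ((m : ℝ) ^ 6 + (m + 1 / 2) ^ 5) / ((N : ℝ) + 1 / 2) ^ 5 =
      -((m : ℝ) ^ 2 / (N + 1 / 2)) -
        ((m : ℝ) ^ 4 / 6 - (m : ℝ) ^ 2 / 12) / ((N : ℝ) + 1 / 2) ^ 3 -
        2 * (m : ℝ) ^ 6 / ((N : ℝ) + 1 / 2) ^ 5 -
        2 * (((m : ℝ) + 1 / 2) / (N + 1 / 2) + (((m : ℝ) + 1 / 2) / (N + 1 / 2)) ^ 3 / 3 +
          (((m : ℝ) + 1 / 2) / (N + 1 / 2)) ^ 5) := by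
      field_simp
      ring
    rw [log_relChoose_succ m_lt]
    push_cast
    linarith

theorem abs_exp_neg_sub_one_sub_le {w : ℝ} (hw : 0 ≤ w) :
    |Real.exp (-w) - (1 - w)| ≤ w ^ 2 / 2 := by
  have lower := Real.add_one_le_exp (-w)
  have upper : Real.exp (-w) ≤ 1 - w + w ^ 2 / 2 := by
    rw [Real.exp_neg]
    refine inv_le_of_inv_le₀ (by nlinarith [sq_nonneg (w - 1)])
      (le_trans ?_ (Real.quadratic_le_exp_of_nonneg hw))
    rw [inv_le_iff_one_le_mul₀ (by nlinarith [sq_nonneg (w - 1)])]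
    nlinarith [sq_nonneg (w ^ 2)]
  rw [abs_le]
  constructor <;> nlinarith [sq_nonneg w]

theorem abs_exp_sub_one_le_of_le_one {x : ℝ} (hx : x ≤ 1) : |Real.exp x - 1| ≤ 2 * |x| := by
  rcases le_or_gt (-1) x with h | h
  · exact Real.abs_exp_sub_one_le (abs_le.2 ⟨h, hx⟩)
  · have exp_le_one : Real.exp x ≤ 1 := Real.exp_le_one_iff.2 (by linarith)
    rw [abs_of_nonpos (by linarith), abs_of_neg (by linarith)]
    linarith [Real.exp_pos x]

theorem abs_exp_neg_mul_exp_sub_le {w ε : ℝ} (hw : 0 ≤ w) (hε : ε ≤ 1) :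
    |Real.exp (-w) * Real.exp ε - (1 - w)| ≤ 2 * |ε| + w ^ 2 / 2 := by
  calc |Real.exp (-w) * Real.exp ε - (1 - w)|
      = |Real.exp (-w) * (Real.exp ε - 1) + (Real.exp (-w) - (1 - w))| := by ring_nf
    _ ≤ Real.exp (-w) * |Real.exp ε - 1| + |Real.exp (-w) - (1 - w)| := by
      refine (abs_add_le _ _).trans_eq ?_
      rw [abs_mul, Real.abs_exp]
    _ ≤ 1 * (2 * |ε|) + w ^ 2 / 2 := by
      gcongr
      · exact Real.exp_le_one_iff.2 (by linarith)
      · exact abs_exp_sub_one_le_of_le_one hε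
      · exact abs_exp_neg_sub_one_sub_le hw
    _ = 2 * |ε| + w ^ 2 / 2 := by rw [one_mul]

section Gaussian

variable {N m : ℕ} {M v : ℝ}

theorem log_relChoose_add_le (hM : M = N + 1 / 2) (hv : v = (m : ℝ) ^ 2 / M) (h : m ≤ N) :
    Real.log (relChoose N m) + v + v ^ 2 / (6 * M) ≤ v / (12 * M ^ 2) := by
  have hM0 : 0 < M := by rw [hM]; positivity
  have upper := log_relChoose_le h
  have quartic : ((m : ℝ) ^ 4 / 6 - (m : ℝ) ^ 2 / 12) / M ^ 3 =
      v ^ 2 / (6 * M) - v / (12 * M ^ 2) := by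
    rw [hv]
    field_simp
  rw [← hM, ← hv, quartic] at upper
  linarith

theorem le_log_relChoose_add (hM : M = N + 1 / 2) (hv : v = (m : ℝ) ^ 2 / M)
    (h : (m : ℝ) ≤ M / 2) :
    v / (12 * M ^ 2) - 2 * v ^ 3 / M ^ 2 ≤ Real.log (relChoose N m) + v + v ^ 2 / (6 * M) := by
  have hM0 : 0 < M := by rw [hM]; positivity
  have lower := le_log_relChoose (N := N) (m := m) (by rwa [← hM])
  have quartic : ((m : ℝ) ^ 4 / 6 - (m : ℝ) ^ 2 / 12) / M ^ 3 =
      v ^ 2 / (6 * M) - v / (12 * M ^ 2) := by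
    rw [hv]
    field_simp
  have sextic : 2 * (m : ℝ) ^ 6 / M ^ 5 = 2 * v ^ 3 / M ^ 2 := by
    rw [hv]
    field_simp
  rw [← hM, ← hv, quartic, sextic] at lower
  linarith

theorem relChoose_le_exp_neg (hM : M = N + 1 / 2) (hv : v = (m : ℝ) ^ 2 / M) :
    relChoose N m ≤ Real.exp (-v) := by
  rcases le_or_gt m N with hm | hm
  · have hM0 : 0 < M := by rw [hM]; positivity
    have upper := log_relChoose_le hm
    rw [← hM, ← hv] at upper
    have quartic_nonneg : 0 ≤ ((m : ℝ) ^ 4 / 6 - (m : ℝ) ^ 2 / 12) / M ^ 3 := by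
      refine div_nonneg ?_ (by positivity)
      rcases Nat.eq_zero_or_pos m with rfl | hm0
      · simp
      · have : (1 : ℝ) ≤ m ^ 2 := one_le_pow₀ (by exact_mod_cast hm0)
        nlinarith
    rw [← Real.log_le_iff_le_exp (relChoose_pos hm)]
    linarith
  · rw [relChoose_eq_zero hm]
    exact (Real.exp_pos _).le

theorem abs_relChoose_sub_le_of_le_half (hN : 0 < N) (hM : M = N + 1 / 2)
    (hv : v = (m : ℝ) ^ 2 / M) (h : (m : ℝ) ≤ M / 2) :
    |relChoose N m - Real.exp (-v) * (1 - v ^ 2 / (6 * M))| ≤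
      (2 * v + 4 * v ^ 3 + v ^ 4) * Real.exp (-v) / M ^ 2 := by
  have hN1 : (1 : ℝ) ≤ N := by exact_mod_cast hN
  have hM1 : 1 ≤ M := by linarith
  have hv0 : 0 ≤ v := by rw [hv]; positivity
  have hvM : v ≤ M := by
    rw [hv, div_le_iff₀ (by positivity)]
    nlinarith [m.cast_nonneg (α := ℝ)]
  have hmN : m ≤ N := by
    have : (m : ℝ) ≤ N := by linarith
    exact_mod_cast this
  have upper := log_relChoose_add_le hM hv hmN
  have lower := le_log_relChoose_add hM hv h
  have factored : relChoose N m = Real.exp (-v) * (Real.exp (-(v ^ 2 / (6 * M))) *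
      Real.exp (Real.log (relChoose N m) + v + v ^ 2 / (6 * M))) := by
    rw [← Real.exp_add, ← Real.exp_add]
    ring_nf
    rw [Real.exp_log (relChoose_pos hmN)]
  set ε := Real.log (relChoose N m) + v + v ^ 2 / (6 * M)
  have ε_le_one : ε ≤ 1 := by
    refine upper.trans ?_
    rw [div_le_one (by positivity)]
    nlinarith
  have abs_ε_le : |ε| ≤ (v + 2 * v ^ 3) / M ^ 2 := by
    have : v / (12 * M ^ 2) ≤ v / M ^ 2 := by gcongr; nlinarith [sq_nonneg M]
    have : 0 ≤ v / (12 * M ^ 2) := by positivity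
    have : 0 ≤ 2 * v ^ 3 / M ^ 2 := by positivity
    rw [abs_le, add_div]
    constructor <;> linarith
  calc |relChoose N m - Real.exp (-v) * (1 - v ^ 2 / (6 * M))|
      = Real.exp (-v) * |Real.exp (-(v ^ 2 / (6 * M))) * Real.exp ε - (1 - v ^ 2 / (6 * M))| := by
        rw [factored, ← mul_sub, abs_mul, Real.abs_exp]
    _ ≤ Real.exp (-v) * (2 * ((v + 2 * v ^ 3) / M ^ 2) + (v ^ 2 / (6 * M)) ^ 2 / 2) := by
        gcongr
        exact (abs_exp_neg_mul_exp_sub_le (by positivity) ε_le_one).trans (by gcongr)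
    _ = (2 * v + 4 * v ^ 3 + v ^ 4 / 72) * Real.exp (-v) / M ^ 2 := by
        field_simp
        ring
    _ ≤ (2 * v + 4 * v ^ 3 + v ^ 4) * Real.exp (-v) / M ^ 2 := by
        gcongr
        linarith [pow_nonneg hv0 4]

/-- Here `v ≥ M / 4`, so that each of the two terms being compared is itself of the order of the
error. -/
theorem abs_relChoose_sub_le_of_half_lt (hM : M = N + 1 / 2) (hv : v = (m : ℝ) ^ 2 / M)
    (h : M / 2 < m) :
    |relChoose N m - Real.exp (-v) * (1 - v ^ 2 / (6 * M))| ≤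
      (32 * v ^ 2 + v ^ 3) * Real.exp (-v) / M ^ 2 := by
  have hM0 : 0 < M := by rw [hM]; positivity
  have hvM : M / 4 ≤ v := by
    rw [hv, le_div_iff₀ hM0]
    nlinarith
  have hw : 0 ≤ v ^ 2 / (6 * M) := by positivity
  have correction_nonneg := mul_nonneg hw (Real.exp_pos (-v)).le
  have trivial_bound : |relChoose N m - Real.exp (-v) * (1 - v ^ 2 / (6 * M))| ≤
      (2 + v ^ 2 / (6 * M)) * Real.exp (-v) := by
    have := relChoose_nonneg N m
    have := relChoose_le_exp_neg (N := N) (m := m) hM hv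
    rw [abs_le]
    constructor <;> nlinarith [Real.exp_pos (-v)]
  refine trivial_bound.trans ?_
  rw [mul_div_right_comm]
  gcongr
  rw [le_div_iff₀ (by positivity)]
  calc (2 + v ^ 2 / (6 * M)) * M ^ 2 = 2 * M ^ 2 + v ^ 2 * M / 6 := by field_simp
    _ ≤ 2 * (4 * v) ^ 2 + v ^ 2 * (4 * v) / 6 := by gcongr <;> linarith
    _ ≤ 32 * v ^ 2 + v ^ 3 := by nlinarith [pow_pos (show 0 < v by linarith) 3]

theorem abs_relChoose_sub_le (hN : 0 < N) (hM : M = N + 1 / 2) (hv : v = (m : ℝ) ^ 2 / M) :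
    |relChoose N m - Real.exp (-v) * (1 - v ^ 2 / (6 * M))| ≤
      32 * (v + v ^ 2 + v ^ 3 + v ^ 4) * Real.exp (-v) / M ^ 2 := by
  have hM0 : 0 < M := by rw [hM]; positivity
  have hv0 : 0 ≤ v := by rw [hv]; positivity
  have := pow_nonneg hv0 2
  have := pow_nonneg hv0 3
  have := pow_nonneg hv0 4
  rcases le_or_gt (m : ℝ) (M / 2) with h | h
  · refine (abs_relChoose_sub_le_of_le_half hN hM hv h).trans ?_
    gcongr
    linarith
  · refine (abs_relChoose_sub_le_of_half_lt hM hv h).trans ?_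
    gcongr
    linarith

theorem branchWeight_sub_eq (hN : 0 < N) (hM : M = N + 1 / 2) (hv : v = (m : ℝ) ^ 2 / M) :
    branchWeight N m -
        ((4 * v - 2) + (2 * v + v ^ 2 / 3 - 2 / 3 * v ^ 3) / M) * Real.exp (-v) =
      (4 * v * (M / N) - 2) * (relChoose N m - Real.exp (-v) * (1 - v ^ 2 / (6 * M))) +
        Real.exp (-v) * ((v - v ^ 3 / 3) * (1 / (N * M))) := by
  have hM0 : 0 < M := by rw [hM]; positivity
  have : (0 : ℝ) < N := by exact_mod_cast hN
  have hmv : (m : ℝ) ^ 2 = v * M := by rw [hv]; field_simp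
  rw [branchWeight, hmv]
  field_simp
  rw [show (N : ℝ) = M - 1 / 2 by linarith]
  ring

end Gaussian

theorem pow_le_one_add_pow {R : Type*} [Semiring R] [LinearOrder R] [IsStrictOrderedRing R]
    {v : R} (hv : 0 ≤ v) {i j : ℕ} (h : i ≤ j) : v ^ i ≤ 1 + v ^ j := by
  rcases le_or_gt v 1 with hv1 | hv1
  · exact (pow_le_one₀ hv hv1).trans (le_add_of_nonneg_right (pow_nonneg hv j))
  · exact (pow_le_pow_right₀ hv1.le h).trans (le_add_of_nonneg_left zero_le_one)

theorem exists_abs_branchWeight_sub_le : ∃ C : ℝ, 0 < C ∧ ∀ N m : ℕ, 0 < N → ∀ M v : ℝ,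
    M = N + 1 / 2 → v = (m : ℝ) ^ 2 / M →
    |branchWeight N m - ((4 * v - 2) + (2 * v + v ^ 2 / 3 - 2 / 3 * v ^ 3) / M) * Real.exp (-v)| ≤
      C / M ^ 2 * ((1 + v ^ 5) * Real.exp (-v)) := by
  refine ⟨2000, by norm_num, fun N m hN M v hM hv => ?_⟩
  have hN1 : (1 : ℝ) ≤ N := by exact_mod_cast hN
  have hM0 : 0 < M := by linarith
  have hv0 : 0 ≤ v := by rw [hv]; positivity
  have ratio_le : M / N ≤ 3 / 2 := by rw [div_le_iff₀ (by positivity)]; linarith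
  have inv_le : 1 / (N * M) ≤ 3 / 2 / M ^ 2 := by
    rw [div_le_div_iff₀ (by positivity) (by positivity)]
    nlinarith
  have factor_le : |4 * v * (M / N) - 2| ≤ 6 * v + 2 := by
    have : 0 ≤ v * (M / N) := by positivity
    rw [abs_le]
    constructor <;> nlinarith
  have remainder_le : |(v - v ^ 3 / 3) * (1 / (N * M))| ≤ (v + v ^ 3) * (3 / 2 / M ^ 2) := by
    rw [abs_mul, abs_of_pos (show 0 < 1 / (N * M) by positivity)]
    gcongr
    rw [abs_le]
    constructor <;> nlinarith [pow_nonneg hv0 3]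
  calc |branchWeight N m -
        ((4 * v - 2) + (2 * v + v ^ 2 / 3 - 2 / 3 * v ^ 3) / M) * Real.exp (-v)|
      ≤ |4 * v * (M / N) - 2| * |relChoose N m - Real.exp (-v) * (1 - v ^ 2 / (6 * M))| +
          Real.exp (-v) * |(v - v ^ 3 / 3) * (1 / (N * M))| := by
        rw [branchWeight_sub_eq hN hM hv]
        refine (abs_add_le _ _).trans_eq ?_
        rw [abs_mul, abs_mul (Real.exp _), Real.abs_exp]
    _ ≤ (6 * v + 2) * (32 * (v + v ^ 2 + v ^ 3 + v ^ 4) * Real.exp (-v) / M ^ 2) +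
          Real.exp (-v) * ((v + v ^ 3) * (3 / 2 / M ^ 2)) := by
        gcongr
        exact abs_relChoose_sub_le hN hM hv
    _ = ((6 * v + 2) * (32 * (v + v ^ 2 + v ^ 3 + v ^ 4)) + 3 / 2 * (v + v ^ 3)) *
          (Real.exp (-v) / M ^ 2) := by ring
    _ ≤ (2000 * (1 + v ^ 5)) * (Real.exp (-v) / M ^ 2) := by
        gcongr
        have := pow_le_one_add_pow hv0 (show 1 ≤ 5 by norm_num)
        have := pow_le_one_add_pow hv0 (show 2 ≤ 5 by norm_num)
        have := pow_le_one_add_pow hv0 (show 3 ≤ 5 by norm_num)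
        have := pow_le_one_add_pow hv0 (show 4 ≤ 5 by norm_num)
        nlinarith
    _ = 2000 / M ^ 2 * ((1 + v ^ 5) * Real.exp (-v)) := by ring

open MeasureTheory Set Filter Topology Asymptotics

/-! ### Euler–Maclaurin summation -/

/-- Lagrange's identity for the operator `d⁴/dx⁴`, with a polynomial centred at `a` as one of the
two functions. -/
theorem hasDerivAt_lagrange_bilinear (p : Polynomial ℝ) {f f₁ f₂ f₃ f₄ : ℝ → ℝ} {x : ℝ}
    (h₀ : HasDerivAt f (f₁ x) x) (h₁ : HasDerivAt f₁ (f₂ x) x)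
    (h₂ : HasDerivAt f₂ (f₃ x) x) (h₃ : HasDerivAt f₃ (f₄ x) x) (a : ℝ) :
    HasDerivAt (fun x => p.eval (x - a) * f₃ x - p.derivative.eval (x - a) * f₂ x +
        p.derivative.derivative.eval (x - a) * f₁ x -
        p.derivative.derivative.derivative.eval (x - a) * f x)
      (p.eval (x - a) * f₄ x -
        p.derivative.derivative.derivative.derivative.eval (x - a) * f x) x := by
  have hp (q : Polynomial ℝ) : HasDerivAt (fun x => q.eval (x - a)) (q.derivative.eval (x - a)) x :=
    (q.hasDerivAt (x - a)).comp_sub_const x a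
  refine (((((hp _).mul h₃).sub ((hp _).mul h₂)).add ((hp _).mul h₁)).sub
    ((hp _).mul h₀)).congr_deriv ?_
  ring

/-- The Peano kernel `x² (1 - x)² / 24` of the corrected trapezoidal rule on `[0, 1]`. -/
noncomputable def trapezoidKernel : Polynomial ℝ :=
  Polynomial.C (1 / 24) *
    (Polynomial.X ^ 2 - Polynomial.C 2 * Polynomial.X ^ 3 + Polynomial.X ^ 4)

theorem eval_trapezoidKernel (x : ℝ) : trapezoidKernel.eval x = x ^ 2 * (1 - x) ^ 2 / 24 := by
  simp only [trapezoidKernel, Polynomial.eval_mul, Polynomial.eval_C, Polynomial.eval_add,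
    Polynomial.eval_sub, Polynomial.eval_pow, Polynomial.eval_X]
  ring

theorem abs_eval_trapezoidKernel_le_one {x : ℝ} (hx : x ∈ Icc (0 : ℝ) 1) :
    |trapezoidKernel.eval x| ≤ 1 := by
  have sq_le : x ^ 2 ≤ 1 := pow_le_one₀ hx.1 hx.2
  have one_sub_sq_le : (1 - x) ^ 2 ≤ 1 := pow_le_one₀ (sub_nonneg.2 hx.2) (by linarith [hx.1])
  have product_le := mul_le_one₀ sq_le (sq_nonneg _) one_sub_sq_le
  rw [eval_trapezoidKernel, abs_of_nonneg (by positivity)]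
  linarith

theorem integral_sub_trapezoid_eq {f f₁ f₂ f₃ f₄ : ℝ → ℝ}
    (h₀ : ∀ x, HasDerivAt f (f₁ x) x) (h₁ : ∀ x, HasDerivAt f₁ (f₂ x) x)
    (h₂ : ∀ x, HasDerivAt f₂ (f₃ x) x) (h₃ : ∀ x, HasDerivAt f₃ (f₄ x) x)
    (h₄ : Continuous f₄) (a : ℝ) :
    (∫ x in a..a + 1, f x) - (f a + f (a + 1)) / 2 + (f₁ (a + 1) - f₁ a) / 12 =
      ∫ x in a..a + 1, trapezoidKernel.eval (x - a) * f₄ x := by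
  have hf : Continuous f := continuous_iff_continuousAt.2 fun x => (h₀ x).continuousAt
  have hw : Continuous fun x => trapezoidKernel.eval (x - a) * f₄ x := by fun_prop
  have fundamental := intervalIntegral.integral_eq_sub_of_hasDerivAt
    (fun x _ => (hasDerivAt_lagrange_bilinear trapezoidKernel (h₀ x) (h₁ x) (h₂ x) (h₃ x)
      a).congr_deriv (g' := trapezoidKernel.eval (x - a) * f₄ x - f x)
        (by simp [trapezoidKernel]; ring_nf))
    ((hw.sub hf).intervalIntegrable a (a + 1))
  rw [intervalIntegral.integral_sub (hw.intervalIntegrable _ _) (hf.intervalIntegrable _ _)]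
    at fundamental
  simp [trapezoidKernel] at fundamental ⊢
  linarith

theorem abs_integral_sub_trapezoid_le {f f₁ f₂ f₃ f₄ : ℝ → ℝ}
    (h₀ : ∀ x, HasDerivAt f (f₁ x) x) (h₁ : ∀ x, HasDerivAt f₁ (f₂ x) x)
    (h₂ : ∀ x, HasDerivAt f₂ (f₃ x) x) (h₃ : ∀ x, HasDerivAt f₃ (f₄ x) x)
    (h₄ : Continuous f₄) (a : ℝ) :
    |(∫ x in a..a + 1, f x) - (f a + f (a + 1)) / 2 + (f₁ (a + 1) - f₁ a) / 12| ≤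
      ∫ x in a..a + 1, |f₄ x| := by
  have hw : Continuous fun x => |trapezoidKernel.eval (x - a) * f₄ x| := by fun_prop
  rw [integral_sub_trapezoid_eq h₀ h₁ h₂ h₃ h₄]
  refine (intervalIntegral.abs_integral_le_integral_abs (by linarith)).trans ?_
  refine intervalIntegral.integral_mono_on (by linarith) (hw.intervalIntegrable _ _)
    (h₄.abs.intervalIntegrable _ _) fun x hx => ?_
  rw [abs_mul]
  exact mul_le_of_le_one_left (abs_nonneg _)
    (abs_eval_trapezoidKernel_le_one ⟨by linarith [hx.1], by linarith [hx.2]⟩)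

theorem abs_integral_sub_sum_range_le {f f₁ f₂ f₃ f₄ : ℝ → ℝ}
    (h₀ : ∀ x, HasDerivAt f (f₁ x) x) (h₁ : ∀ x, HasDerivAt f₁ (f₂ x) x)
    (h₂ : ∀ x, HasDerivAt f₂ (f₃ x) x) (h₃ : ∀ x, HasDerivAt f₃ (f₄ x) x)
    (h₄ : Continuous f₄) (n : ℕ) :
    |(∫ x in (0 : ℝ)..n, f x) - (∑ k ∈ Finset.range n, f (k + 1)) - (f 0 - f n) / 2 +
        (f₁ n - f₁ 0) / 12| ≤ ∫ x in (0 : ℝ)..n, |f₄ x| := by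
  have hf : Continuous f := continuous_iff_continuousAt.2 fun x => (h₀ x).continuousAt
  induction n with
  | zero => simp
  | succ n ih =>
    rw [Finset.sum_range_succ]
    push_cast
    rw [← intervalIntegral.integral_add_adjacent_intervals (hf.intervalIntegrable 0 n)
      (hf.intervalIntegrable n (n + 1)), ← intervalIntegral.integral_add_adjacent_intervals
      (h₄.abs.intervalIntegrable 0 n) (h₄.abs.intervalIntegrable n (n + 1))]
    refine le_trans (le_of_eq ?_) ((abs_add_le _ _).trans
      (add_le_add ih (abs_integral_sub_trapezoid_le h₀ h₁ h₂ h₃ h₄ n)))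
    congr 1
    ring

theorem abs_integral_sub_tsum_le {f f₁ f₂ f₃ f₄ : ℝ → ℝ}
    (h₀ : ∀ x, HasDerivAt f (f₁ x) x) (h₁ : ∀ x, HasDerivAt f₁ (f₂ x) x)
    (h₂ : ∀ x, HasDerivAt f₂ (f₃ x) x) (h₃ : ∀ x, HasDerivAt f₃ (f₄ x) x)
    (h₄ : Continuous f₄) (hf : IntegrableOn f (Ioi 0)) (hf₁ : IntegrableOn f₁ (Ioi 0))
    (hf₂ : IntegrableOn f₂ (Ioi 0)) (hf₄ : IntegrableOn f₄ (Ioi 0))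
    (hs : Summable fun k : ℕ => f (k + 1)) :
    |(∫ x in Ioi 0, f x) - (∑' k : ℕ, f (k + 1)) - f 0 / 2 - f₁ 0 / 12| ≤
      ∫ x in Ioi 0, |f₄ x| := by
  have error_le (n : ℕ) : ∫ x in (0 : ℝ)..n, |f₄ x| ≤ ∫ x in Ioi 0, |f₄ x| := by
    rw [intervalIntegral.integral_of_le (by positivity)]
    exact setIntegral_mono_set hf₄.abs (Eventually.of_forall fun x => abs_nonneg _)
      (Eventually.of_forall fun x hx => hx.1)
  have tendsto_f : Tendsto (fun n : ℕ => f n) atTop (𝓝 0) :=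
    (tendsto_zero_of_hasDerivAt_of_integrableOn_Ioi (a := 0) (fun x _ => h₀ x) hf₁ hf).comp
      tendsto_natCast_atTop_atTop
  have tendsto_f₁ : Tendsto (fun n : ℕ => f₁ n) atTop (𝓝 0) :=
    (tendsto_zero_of_hasDerivAt_of_integrableOn_Ioi (a := 0) (fun x _ => h₁ x) hf₂ hf₁).comp
      tendsto_natCast_atTop_atTop
  have tendsto_integral := intervalIntegral_tendsto_integral_Ioi (μ := volume) 0 hf
    (tendsto_natCast_atTop_atTop (R := ℝ))
  have tendsto_abs := (((tendsto_integral.sub hs.hasSum.tendsto_sum_nat).sub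
    ((tendsto_f.const_sub (f 0)).div_const 2)).add
      ((tendsto_f₁.sub_const (f₁ 0)).div_const 12)).abs
  refine le_trans (le_of_eq ?_) (le_of_tendsto tendsto_abs (Eventually.of_forall fun n =>
    (abs_integral_sub_sum_range_le h₀ h₁ h₂ h₃ h₄ n).trans (error_le n)))
  congr 1
  ring

/-! ### Polynomials times a Gaussian -/

/-- The polynomial `Q` such that the derivative of `P e^{-x²}` is `Q e^{-x²}`. -/
noncomputable def gaussDeriv (P : Polynomial ℝ) : Polynomial ℝ :=
  P.derivative - Polynomial.C 2 * Polynomial.X * P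

/-- The function `P e^{-x²}` for a polynomial `P`. -/
noncomputable def polyGauss (P : Polynomial ℝ) (x : ℝ) : ℝ := P.eval x * Real.exp (-x ^ 2)

theorem hasDerivAt_polyGauss (P : Polynomial ℝ) (x : ℝ) :
    HasDerivAt (polyGauss P) (polyGauss (gaussDeriv P) x) x := by
  refine ((P.hasDerivAt x).mul (((hasDerivAt_id x).pow 2).neg.exp)).congr_deriv ?_
  simp [polyGauss, gaussDeriv]
  ring

theorem continuous_polyGauss (P : Polynomial ℝ) : Continuous (polyGauss P) := by
  unfold polyGauss
  fun_prop

theorem integrableOn_polyGauss (P : Polynomial ℝ) : IntegrableOn (polyGauss P) (Ioi 0) := by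
  induction P using Polynomial.induction_on' with
  | add p q hp hq =>
    refine (hp.add hq).congr_fun (fun x _ => ?_) measurableSet_Ioi
    simp [polyGauss, add_mul]
  | monomial n a =>
    have power_integrable := (integrableOn_rpow_mul_exp_neg_mul_sq (b := 1) one_pos (s := n)
      (by linarith [n.cast_nonneg (α := ℝ)])).const_mul a
    refine IntegrableOn.congr_fun power_integrable (fun x _ => ?_) measurableSet_Ioi
    simp [polyGauss, mul_assoc]

theorem integral_polyGauss_X_pow (j : ℕ) :
    ∫ x in Ioi 0, polyGauss (Polynomial.X ^ (2 * j + 1)) x = j.factorial / 2 := by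
  have gamma_integral := integral_rpow_mul_exp_neg_rpow (p := 2) (q := (2 * j + 1 : ℕ))
    (by norm_num) (by linarith [(2 * j + 1).cast_nonneg (α := ℝ)])
  have half_exponent : (((2 * j + 1 : ℕ) : ℝ) + 1) / 2 = j + 1 := by
    push_cast
    ring
  rw [half_exponent, Real.Gamma_nat_eq_factorial] at gamma_integral
  rw [← one_div_mul_eq_div, ← gamma_integral]
  refine setIntegral_congr_fun measurableSet_Ioi fun x _ => ?_
  simp only [polyGauss, Polynomial.eval_pow, Polynomial.eval_X, Real.rpow_natCast]
  norm_num

theorem abs_integral_polyGauss_sub_tsum_le (P : Polynomial ℝ) {a : ℝ} (ha : 0 < a)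
    (hs : Summable fun k : ℕ => polyGauss P (a * (k + 1))) :
    |(∫ x in Ioi 0, polyGauss P x) / a - (∑' k : ℕ, polyGauss P (a * (k + 1))) -
        polyGauss P 0 / 2 - a * polyGauss (gaussDeriv P) 0 / 12| ≤
      a ^ 3 * ∫ x in Ioi 0, |polyGauss (gaussDeriv^[4] P) x| := by
  have deriv_scaled (i : ℕ) (x : ℝ) :
      HasDerivAt (fun x => a ^ i * polyGauss (gaussDeriv^[i] P) (a * x))
        (a ^ (i + 1) * polyGauss (gaussDeriv^[i + 1] P) (a * x)) x := by
    rw [Function.iterate_succ_apply']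
    refine (((hasDerivAt_polyGauss _ (a * x)).comp x
      ((hasDerivAt_id x).const_mul a)).const_mul (a ^ i)).congr_deriv ?_
    simp
    ring
  have integrable_scaled (i : ℕ) :
      IntegrableOn (fun x => a ^ i * polyGauss (gaussDeriv^[i] P) (a * x)) (Ioi 0) :=
    ((integrableOn_Ioi_comp_mul_left_iff (polyGauss _) 0 ha).2
      (by rw [mul_zero]; exact integrableOn_polyGauss _)).const_mul _
  have integral_scaled : ∫ x in Ioi 0, a ^ 0 * polyGauss P (a * x) =
      (∫ x in Ioi 0, polyGauss P x) / a := by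
    simp only [pow_zero, one_mul]
    rw [integral_comp_mul_left_Ioi (polyGauss P) 0 ha, mul_zero, smul_eq_mul, inv_mul_eq_div]
  have integral_error : ∫ x in Ioi 0, |a ^ 4 * polyGauss (gaussDeriv^[4] P) (a * x)| =
      a ^ 3 * ∫ x in Ioi 0, |polyGauss (gaussDeriv^[4] P) x| := by
    simp_rw [abs_mul]
    rw [integral_const_mul, integral_comp_mul_left_Ioi (fun x => |polyGauss _ x|) 0 ha, mul_zero,
      abs_of_pos (by positivity), smul_eq_mul]
    field_simp
  have euler_maclaurin := abs_integral_sub_tsum_le (deriv_scaled 0) (deriv_scaled 1)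
    (deriv_scaled 2) (deriv_scaled 3)
    (((continuous_polyGauss _).comp (continuous_const_mul a)).const_mul _)
    (integrable_scaled 0) (integrable_scaled 1) (integrable_scaled 2) (integrable_scaled 4)
    (by simpa using hs)
  rw [integral_error] at euler_maclaurin
  refine le_trans (le_of_eq ?_) euler_maclaurin
  simp only [Function.iterate_zero, id, integral_scaled]
  simp

/-! ### The sums `∑ k (k² t)^j e^{-k² t}` -/

/-- The function `∑_{k ≥ 1} k (k² t)^j e^{-k² t}`. -/
noncomputable def expSum (j : ℕ) (t : ℝ) : ℝ :=
  ∑' k : ℕ, ((k : ℝ) + 1) * ((((k : ℝ) + 1) ^ 2 * t) ^ j * Real.exp (-(((k : ℝ) + 1) ^ 2 * t)))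

theorem pow_mul_exp_neg_le {u : ℝ} (hu : 0 ≤ u) (j : ℕ) :
    u ^ j * Real.exp (-u) ≤ j.factorial := by
  have := Real.pow_div_factorial_le_exp u hu j
  rw [Real.exp_neg, ← div_eq_mul_inv, div_le_iff₀ (Real.exp_pos u)]
  rwa [div_le_iff₀ (by positivity), mul_comm] at this

theorem expSum_term_le (j : ℕ) {t : ℝ} (ht : 0 < t) (k : ℕ) :
    ((k : ℝ) + 1) * ((((k : ℝ) + 1) ^ 2 * t) ^ j * Real.exp (-(((k : ℝ) + 1) ^ 2 * t))) ≤
      (j + 2).factorial / t ^ 2 * (1 / (((k + 1 : ℕ) : ℝ)) ^ 3) := by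
  have term_bound := pow_mul_exp_neg_le (u := ((k : ℝ) + 1) ^ 2 * t) (by positivity) (j + 2)
  push_cast
  rw [div_mul_div_comm, mul_one, le_div_iff₀ (by positivity)]
  refine le_trans (le_of_eq ?_) term_bound
  ring

theorem summable_one_div_succ_cube : Summable fun k : ℕ => 1 / (((k + 1 : ℕ) : ℝ)) ^ 3 :=
  (summable_nat_add_iff 1).2 (Real.summable_one_div_nat_pow.2 (by norm_num))

theorem summable_expSum (j : ℕ) {t : ℝ} (ht : 0 < t) : Summable fun k : ℕ =>
    ((k : ℝ) + 1) * ((((k : ℝ) + 1) ^ 2 * t) ^ j * Real.exp (-(((k : ℝ) + 1) ^ 2 * t))) :=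
  Summable.of_nonneg_of_le (fun k => by positivity) (expSum_term_le j ht)
    (summable_one_div_succ_cube.mul_left _)

theorem expSum_nonneg (j : ℕ) {t : ℝ} (ht : 0 < t) : 0 ≤ expSum j t :=
  tsum_nonneg fun k => by positivity

theorem exists_expSum_le_div_sq (j : ℕ) :
    ∃ C : ℝ, 0 ≤ C ∧ ∀ t : ℝ, 0 < t → expSum j t ≤ C / t ^ 2 := by
  refine ⟨(j + 2).factorial * ∑' k : ℕ, 1 / (((k + 1 : ℕ) : ℝ)) ^ 3,
    mul_nonneg (by positivity) (tsum_nonneg fun k => by positivity), fun t ht => ?_⟩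
  calc expSum j t ≤ ∑' k : ℕ, (j + 2).factorial / t ^ 2 * (1 / (((k + 1 : ℕ) : ℝ)) ^ 3) :=
        (summable_expSum j ht).tsum_le_tsum (expSum_term_le j ht)
          (summable_one_div_succ_cube.mul_left _)
    _ = (j + 2).factorial * (∑' k : ℕ, 1 / (((k + 1 : ℕ) : ℝ)) ^ 3) / t ^ 2 := by
        rw [tsum_mul_left]
        ring

theorem continuousOn_expSum (j : ℕ) : ContinuousOn (expSum j) (Ioi 0) := by
  intro t₀ ht₀
  have half_pos : 0 < t₀ / 2 := half_pos ht₀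
  have continuousOn_Ioi_half : ContinuousOn (expSum j) (Ioi (t₀ / 2)) := by
    refine continuousOn_tsum (u := fun k : ℕ => (j + 2).factorial / (t₀ / 2) ^ 2 *
      (1 / (((k + 1 : ℕ) : ℝ)) ^ 3)) (fun k => by fun_prop)
      (summable_one_div_succ_cube.mul_left _) fun k t ht => ?_
    rw [mem_Ioi] at ht
    rw [Real.norm_of_nonneg (by have := half_pos.trans ht; positivity)]
    exact (expSum_term_le j (half_pos.trans ht) k).trans (by gcongr)
  exact (continuousOn_Ioi_half.continuousAt
    (Ioi_mem_nhds (half_lt_self ht₀))).continuousWithinAt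

theorem polyGauss_X_pow_sqrt_mul (j : ℕ) {t : ℝ} (ht : 0 ≤ t) (x : ℝ) :
    polyGauss (Polynomial.X ^ (2 * j + 1)) (√t * x) =
      √t * (x * ((x ^ 2 * t) ^ j * Real.exp (-(x ^ 2 * t)))) := by
  simp only [polyGauss, Polynomial.eval_pow, Polynomial.eval_X]
  rw [pow_succ, pow_mul, mul_pow, Real.sq_sqrt ht, mul_comm t]
  ring

theorem exists_abs_expSum_sub_le (j : ℕ) : ∃ C : ℝ, 0 ≤ C ∧ ∀ t : ℝ, 0 < t →
    |expSum j t - j.factorial / 2 / t + (if j = 0 then 1 else 0) / 12| ≤ C * t := by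
  refine ⟨∫ x in Ioi 0, |polyGauss (gaussDeriv^[4] (Polynomial.X ^ (2 * j + 1))) x|,
    integral_nonneg fun x => abs_nonneg _, fun t ht => ?_⟩
  have hs : 0 < √t := Real.sqrt_pos.2 ht
  have terms (k : ℕ) := polyGauss_X_pow_sqrt_mul j ht.le ((k : ℝ) + 1)
  have deriv_at_zero : polyGauss (gaussDeriv (Polynomial.X ^ (2 * j + 1))) 0 =
      if j = 0 then 1 else 0 := by
    rcases j with _ | j <;> simp [polyGauss, gaussDeriv]
  have scaled_bound := abs_integral_polyGauss_sub_tsum_le (Polynomial.X ^ (2 * j + 1)) hs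
    (by simpa only [terms] using (summable_expSum j ht).mul_left _)
  simp_rw [terms, tsum_mul_left, deriv_at_zero, integral_polyGauss_X_pow] at scaled_bound
  rw [show polyGauss (Polynomial.X ^ (2 * j + 1)) 0 = 0 by simp [polyGauss]] at scaled_bound
  refine le_of_mul_le_mul_left (le_trans (le_of_eq ?_) (scaled_bound.trans_eq ?_)) hs
  · rw [← abs_of_pos hs, ← abs_mul, abs_of_pos hs, ← abs_neg, expSum]
    congr 1
    field_simp
    rw [Real.sq_sqrt ht.le]
    ring_nf
  · rw [pow_succ, Real.sq_sqrt ht.le]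
    ring

/-! ### The Mellin transform of the harmonic sum -/

theorem exists_expSum_le_div (j : ℕ) : ∃ C : ℝ, 0 ≤ C ∧ ∀ t : ℝ, 0 < t → expSum j t ≤ C / t := by
  obtain ⟨C, hC, bound_small⟩ := exists_abs_expSum_sub_le j
  obtain ⟨D, hD, bound_large⟩ := exists_expSum_le_div_sq j
  refine ⟨C + D + j.factorial / 2, by positivity, fun t ht => ?_⟩
  rw [add_div, add_div]
  have hC' : 0 ≤ C / t := by positivity
  have hD' : 0 ≤ D / t := by positivity
  have hj : 0 ≤ (j.factorial : ℝ) / 2 / t := by positivity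
  rcases le_or_gt t 1 with ht1 | ht1
  · have correction_nonneg : (0 : ℝ) ≤ (if j = 0 then 1 else 0) / 12 := by
      split_ifs <;> norm_num
    have : C * t ≤ C / t := by
      rw [le_div_iff₀ ht, mul_assoc]
      exact mul_le_of_le_one_right hC (mul_le_one₀ ht1 ht.le ht1)
    linarith [(abs_le.1 (bound_small t ht)).2]
  · have : D / t ^ 2 ≤ D / t := by
      gcongr
      exact le_self_pow₀ ht1.le two_ne_zero
    linarith [bound_large t ht]

theorem isBigO_expSum_atTop (j : ℕ) :
    (fun t => (expSum j t : ℂ)) =O[atTop] (· ^ (-(2 : ℝ)) : ℝ → ℝ) := by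
  obtain ⟨C, _, bound⟩ := exists_expSum_le_div_sq j
  refine IsBigO.of_bound C ?_
  filter_upwards [eventually_gt_atTop 0] with t ht
  rw [Complex.norm_real, Real.norm_of_nonneg (expSum_nonneg j ht),
    Real.norm_of_nonneg (by positivity), Real.rpow_neg ht.le, ← div_eq_mul_inv]
  exact_mod_cast bound t ht

theorem isBigO_expSum_nhdsGT_zero (j : ℕ) :
    (fun t => (expSum j t : ℂ)) =O[𝓝[>] 0] (· ^ (-(1 : ℝ)) : ℝ → ℝ) := by
  obtain ⟨C, _, bound⟩ := exists_expSum_le_div j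
  refine IsBigO.of_bound C ?_
  filter_upwards [self_mem_nhdsWithin] with t (ht : 0 < t)
  rw [Complex.norm_real, Real.norm_of_nonneg (expSum_nonneg j ht),
    Real.norm_of_nonneg (by positivity), Real.rpow_neg ht.le, ← div_eq_mul_inv, Real.rpow_one]
  exact bound t ht

theorem locallyIntegrableOn_ofReal_comp {f : ℝ → ℝ} {s : Set ℝ} (hf : ContinuousOn f s)
    (hs : MeasurableSet s) : LocallyIntegrableOn (fun t => (f t : ℂ)) s :=
  (Complex.continuous_ofReal.comp_continuousOn hf).locallyIntegrableOn hs

theorem mellinConvergent_expSum (j : ℕ) {s : ℂ} (hs1 : 1 < s.re) (hs2 : s.re < 2) :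
    MellinConvergent (fun t => (expSum j t : ℂ)) s :=
  mellinConvergent_of_isBigO_rpow
    (locallyIntegrableOn_ofReal_comp (continuousOn_expSum j) measurableSet_Ioi)
    (isBigO_expSum_atTop j) hs2 (isBigO_expSum_nhdsGT_zero j) hs1

theorem hasSum_expSum (j : ℕ) {t : ℝ} (ht : 0 < t) :
    HasSum (fun k : ℕ => (((k : ℝ) + 1) ^ (2 * j + 1) : ℝ) *
      (Real.exp (-((k : ℝ) + 1) ^ 2 * t) : ℂ)) ((t : ℂ) ^ (-j : ℂ) • (expSum j t : ℂ)) := by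
  have real_sum := (summable_expSum j ht).hasSum.mul_left ((t ^ j)⁻¹)
  convert! Complex.hasSum_ofReal.2 real_sum using 1
  · funext k
    rw [← Complex.ofReal_mul, neg_mul, mul_pow, ← pow_mul]
    congr 1
    field_simp
    ring
  · rw [Complex.cpow_neg, Complex.cpow_natCast, smul_eq_mul, expSum]
    push_cast
    rfl

theorem succ_pow_div_sq_cpow (j k : ℕ) (s : ℂ) :
    ((((k : ℝ) + 1) ^ (2 * j + 1) : ℝ) : ℂ) / (((k : ℝ) + 1) ^ 2 : ℝ) ^ (s + j) =
      1 / ((k + 1 : ℕ) : ℂ) ^ (2 * s - 1) := by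
  have hk : ((k + 1 : ℕ) : ℂ) ≠ 0 := Nat.cast_ne_zero.2 k.succ_ne_zero
  have sq_cpow : ((((k : ℝ) + 1) ^ 2 : ℝ) : ℂ) ^ (s + j) = ((k + 1 : ℕ) : ℂ) ^ (2 * (s + j)) := by
    have mul_cpow := Complex.natCast_mul_natCast_cpow (k + 1) (k + 1) (s + j)
    rw [two_mul, Complex.cpow_add _ _ hk, ← mul_cpow]
    push_cast
    rw [sq]
  rw [sq_cpow, show ((((k : ℝ) + 1) ^ (2 * j + 1) : ℝ) : ℂ) =
    ((k + 1 : ℕ) : ℂ) ^ ((2 * j + 1 : ℕ) : ℂ) by rw [Complex.cpow_natCast]; push_cast; rfl,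
    ← Complex.cpow_sub _ _ hk, one_div, ← Complex.cpow_neg]
  congr 1
  push_cast
  ring

theorem mellin_expSum (j : ℕ) {s : ℂ} (hs : 1 < s.re) :
    mellin (fun t => (expSum j t : ℂ)) s = Complex.Gamma (s + j) * riemannZeta (2 * s - 1) := by
  have hs' : 1 < (2 * s - 1).re := by
    simp only [Complex.sub_re, Complex.mul_re, Complex.re_ofNat, Complex.im_ofNat, zero_mul,
      sub_zero, Complex.one_re]
    linarith
  have dirichlet_summable : Summable fun k : ℕ =>
      ‖((((k : ℝ) + 1) ^ (2 * j + 1) : ℝ) : ℂ)‖ / (((k : ℝ) + 1) ^ 2) ^ (s + j).re := by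
    have zeta_summable := (summable_nat_add_iff 1).2 (Complex.summable_one_div_nat_cpow.2 hs').norm
    refine zeta_summable.congr fun k => ?_
    rw [← succ_pow_div_sq_cpow j, norm_div, Complex.norm_cpow_eq_rpow_re_of_pos (by positivity)]
  have termwise := hasSum_mellin (p := fun k : ℕ => ((k : ℝ) + 1) ^ 2) (s := s + j)
    (fun k => Or.inr (by positivity))
    (by rw [Complex.add_re, Complex.natCast_re]; positivity)
    (fun t ht => hasSum_expSum j ht) dirichlet_summable
  rw [mellin_cpow_smul, add_neg_cancel_right] at termwise
  simp_rw [← termwise.tsum_eq, mul_div_assoc, succ_pow_div_sq_cpow, tsum_mul_left]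
  rw [zeta_eq_tsum_one_div_nat_add_one_cpow hs']
  push_cast
  rfl

/-- The harmonic sum `∑_{k ≥ 1} k (4 k² t - 2) e^{-k² t}`, whose values at `t = 4 ^ r / (n + 3 / 2)`
are the leading parts of the expected numbers of `r`-branches. -/
noncomputable def branchSum (t : ℝ) : ℝ := 4 * expSum 1 t - 2 * expSum 0 t

theorem exists_abs_branchSum_sub_le : ∃ C : ℝ, 0 ≤ C ∧ ∀ t : ℝ, 0 < t →
    |branchSum t - 1 / t - 1 / 6| ≤ C * t := by
  obtain ⟨C₀, hC₀, bound₀⟩ := exists_abs_expSum_sub_le 0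
  obtain ⟨C₁, hC₁, bound₁⟩ := exists_abs_expSum_sub_le 1
  refine ⟨4 * C₁ + 2 * C₀, by positivity, fun t ht => ?_⟩
  calc |branchSum t - 1 / t - 1 / 6|
      = |4 * (expSum 1 t - (1 : ℕ).factorial / 2 / t + (if 1 = 0 then 1 else 0) / 12) -
          2 * (expSum 0 t - (0 : ℕ).factorial / 2 / t + (if 0 = 0 then 1 else 0) / 12)| := by
        simp only [branchSum, Nat.factorial, one_ne_zero, if_true, if_false]
        push_cast
        ring_nf
    _ ≤ 4 * (C₁ * t) + 2 * (C₀ * t) := by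
        refine (abs_sub _ _).trans (add_le_add ?_ ?_) <;> rw [abs_mul, abs_of_pos (by norm_num)]
        · exact mul_le_mul_of_nonneg_left (bound₁ t ht) (by norm_num)
        · exact mul_le_mul_of_nonneg_left (bound₀ t ht) (by norm_num)
    _ = (4 * C₁ + 2 * C₀) * t := by ring

theorem exists_abs_branchSum_le :
    ∃ C : ℝ, 0 ≤ C ∧ ∀ t : ℝ, 0 < t → |branchSum t| ≤ C / t ^ 2 := by
  obtain ⟨C₀, hC₀, bound₀⟩ := exists_expSum_le_div_sq 0
  obtain ⟨C₁, hC₁, bound₁⟩ := exists_expSum_le_div_sq 1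
  refine ⟨4 * C₁ + 2 * C₀, by positivity, fun t ht => ?_⟩
  rw [branchSum, abs_le, add_div, mul_div_assoc, mul_div_assoc]
  constructor <;>
    linarith [bound₀ t ht, bound₁ t ht, expSum_nonneg 0 ht, expSum_nonneg 1 ht]

theorem continuousOn_branchSum : ContinuousOn branchSum (Ioi 0) :=
  ((continuousOn_expSum 1).const_mul 4).sub ((continuousOn_expSum 0).const_mul 2)

/-- The function `branchSum` minus its singular part `1 / t + 1 / 6` on `(0, 1]`. Its Mellin
transform is holomorphic in the strip `-1 < re s < 2`, which contains the poles `0` and `1` of the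
continued Mellin transform of `branchSum`. -/
noncomputable def branchSumReg (t : ℝ) : ℂ :=
  (branchSum t : ℂ) - (indicator (Ioc 0 1) (fun t : ℝ => (t : ℂ) ^ (-1 : ℂ)) t +
    (1 / 6 : ℂ) • indicator (Ioc 0 1) (fun _ => (1 : ℂ)) t)

theorem branchSumReg_of_le {t : ℝ} (ht0 : 0 < t) (ht1 : t ≤ 1) :
    branchSumReg t = ((branchSum t - 1 / t - 1 / 6 : ℝ) : ℂ) := by
  have ht : t ∈ Ioc (0 : ℝ) 1 := ⟨ht0, ht1⟩
  rw [branchSumReg, indicator_of_mem ht, indicator_of_mem ht, Complex.cpow_neg_one, smul_eq_mul]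
  push_cast
  ring

theorem branchSumReg_of_lt {t : ℝ} (ht : 1 < t) : branchSumReg t = (branchSum t : ℂ) := by
  have ht' : t ∉ Ioc (0 : ℝ) 1 := fun h => h.2.not_gt ht
  rw [branchSumReg, indicator_of_notMem ht', indicator_of_notMem ht', smul_zero, add_zero, sub_zero]

theorem isBigO_branchSumReg_atTop :
    branchSumReg =O[atTop] (· ^ (-(2 : ℝ)) : ℝ → ℝ) := by
  obtain ⟨C, _, bound⟩ := exists_abs_branchSum_le
  refine IsBigO.of_bound C ?_
  filter_upwards [eventually_gt_atTop 1] with t ht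
  have ht0 : 0 < t := one_pos.trans ht
  rw [branchSumReg_of_lt ht, Complex.norm_real, Real.norm_eq_abs,
    Real.norm_of_nonneg (by positivity), Real.rpow_neg ht0.le, ← div_eq_mul_inv]
  exact_mod_cast bound t ht0

theorem isBigO_branchSumReg_nhdsGT_zero :
    branchSumReg =O[𝓝[>] 0] (· ^ (-(-1 : ℝ)) : ℝ → ℝ) := by
  obtain ⟨C, _, bound⟩ := exists_abs_branchSum_sub_le
  refine IsBigO.of_bound C ?_
  filter_upwards [Ioc_mem_nhdsGT (zero_lt_one (α := ℝ))] with t ht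
  rw [branchSumReg_of_le ht.1 ht.2, Complex.norm_real, Real.norm_eq_abs, neg_neg, Real.rpow_one,
    Real.norm_of_nonneg ht.1.le]
  exact bound t ht.1

theorem locallyIntegrableOn_indicator {f : ℝ → ℂ} {s u : Set ℝ} (hf : LocallyIntegrableOn f s)
    (hu : MeasurableSet u) : LocallyIntegrableOn (indicator u f) s := fun t ht =>
  (hf t ht).imp fun _ hv => ⟨hv.1, hv.2.indicator hu⟩

theorem locallyIntegrableOn_branchSumReg : LocallyIntegrableOn branchSumReg (Ioi 0) := by
  have inv_integrable : LocallyIntegrableOn (fun t : ℝ => (t : ℂ) ^ (-1 : ℂ)) (Ioi 0) := by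
    refine ContinuousOn.locallyIntegrableOn (fun t ht => ?_) measurableSet_Ioi
    simp_rw [Complex.cpow_neg_one]
    exact (Complex.continuous_ofReal.continuousAt.inv₀
      (Complex.ofReal_ne_zero.2 (ne_of_gt ht))).continuousWithinAt
  have one_integrable : LocallyIntegrableOn (fun _ : ℝ => (1 : ℂ)) (Ioi 0) :=
    continuousOn_const.locallyIntegrableOn measurableSet_Ioi
  exact (locallyIntegrableOn_ofReal_comp continuousOn_branchSum measurableSet_Ioi).sub
    ((locallyIntegrableOn_indicator inv_integrable measurableSet_Ioc).add
      ((locallyIntegrableOn_indicator one_integrable measurableSet_Ioc).smul (1 / 6 : ℂ)))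

theorem mellinConvergent_branchSumReg {s : ℂ} (hs1 : -1 < s.re) (hs2 : s.re < 2) :
    MellinConvergent branchSumReg s :=
  mellinConvergent_of_isBigO_rpow locallyIntegrableOn_branchSumReg isBigO_branchSumReg_atTop hs2
    isBigO_branchSumReg_nhdsGT_zero hs1

theorem differentiableAt_mellin_branchSumReg {s : ℂ} (hs1 : -1 < s.re) (hs2 : s.re < 2) :
    DifferentiableAt ℂ (mellin branchSumReg) s :=
  mellin_differentiableAt_of_isBigO_rpow locallyIntegrableOn_branchSumReg
    isBigO_branchSumReg_atTop hs2 isBigO_branchSumReg_nhdsGT_zero hs1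

theorem mellin_branchSumReg_of_one_lt_re {s : ℂ} (hs1 : 1 < s.re) (hs2 : s.re < 2) :
    mellin branchSumReg s = (4 * s - 2) * Complex.Gamma s * riemannZeta (2 * s - 1) -
      1 / (s - 1) - 1 / (6 * s) := by
  have hs0 : s ≠ 0 := fun h => by norm_num [h] at hs1
  have main₁ := hasMellin_const_smul (mellinConvergent_expSum 1 hs1 hs2) (4 : ℂ)
  have main₀ := hasMellin_const_smul (mellinConvergent_expSum 0 hs1 hs2) (2 : ℂ)
  have pole₁ := hasMellin_cpow_Ioc (-1) (s := s)
    (by rw [Complex.neg_re, Complex.one_re]; linarith)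
  have pole₀ := hasMellin_one_Ioc (s := s) (by linarith)
  have scaled_pole₀ := hasMellin_const_smul pole₀.1 (1 / 6 : ℂ)
  have main := hasMellin_sub main₁.1 main₀.1
  have poles := hasMellin_add pole₁.1 scaled_pole₀.1
  have difference := (hasMellin_sub main.1 poles.1).2
  rw [main.2, poles.2, main₁.2, main₀.2, pole₁.2, scaled_pole₀.2, pole₀.2, mellin_expSum 1 hs1,
    mellin_expSum 0 hs1, Nat.cast_one, Nat.cast_zero, add_zero, Complex.Gamma_add_one s hs0]
    at difference
  have decomposition : branchSumReg = fun t =>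
      ((4 : ℂ) • (expSum 1 t : ℂ) - (2 : ℂ) • (expSum 0 t : ℂ)) -
        (indicator (Ioc 0 1) (fun t : ℝ => (t : ℂ) ^ (-1 : ℂ)) t +
          (1 / 6 : ℂ) • indicator (Ioc 0 1) (fun _ => (1 : ℂ)) t) := by
    funext t
    simp [branchSumReg, branchSum]
  rw [decomposition, difference]
  simp only [smul_eq_mul]
  field_simp
  ring

/-- The entire function `(w - 1) ζ(w)`, with its value at the removable singularity `1`. -/
noncomputable def subOneMulZeta : ℂ → ℂ := Function.update (fun w => (w - 1) * riemannZeta w) 1 1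

theorem subOneMulZeta_of_ne {w : ℂ} (hw : w ≠ 1) : subOneMulZeta w = (w - 1) * riemannZeta w :=
  Function.update_of_ne hw _ _

theorem differentiable_subOneMulZeta : Differentiable ℂ subOneMulZeta := by
  rw [← differentiableOn_univ,
    ← Complex.differentiableOn_compl_singleton_and_continuousAt_iff (c := 1) univ_mem]
  refine ⟨DifferentiableOn.congr (f := fun w => (w - 1) * riemannZeta w) (fun w hw => ?_)
    fun w hw => subOneMulZeta_of_ne hw.2, continuousAt_update_same.2 riemannZeta_residue_one⟩
  exact ((differentiableAt_id.sub_const 1).mul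
    (differentiableAt_riemannZeta hw.2)).differentiableWithinAt

theorem riemannZeta_neg_one : riemannZeta (-1) = -1 / 12 := by
  have := riemannZeta_neg_nat_eq_bernoulli 1
  norm_num [bernoulli_two] at this
  rw [this]
  norm_num

theorem hasDerivAt_subOneMulZeta {w : ℂ} (hw : w ≠ 1) :
    HasDerivAt subOneMulZeta (riemannZeta w + (w - 1) * deriv riemannZeta w) w := by
  have product_rule := ((hasDerivAt_id w).sub_const 1).mul
    (differentiableAt_riemannZeta hw).hasDerivAt
  rw [one_mul] at product_rule
  exact product_rule.congr_of_eventuallyEq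
    ((eventually_ne_nhds hw).mono fun z hz => subOneMulZeta_of_ne hz)

/-- The function `s (s - 1) M(s)`, where `M` is the Mellin transform of `branchSumReg`, in a form
without singularities in the half-plane `-1 < re s`. -/
noncomputable def mellinNumerator (s : ℂ) : ℂ :=
  (4 * s - 2) * Complex.Gamma (s + 1) * (subOneMulZeta (2 * s - 1) / 2) - s - (s - 1) / 6

theorem mellinNumerator_of_ne {s : ℂ} (hs0 : s ≠ 0) (hs1 : s ≠ 1) :
    mellinNumerator s = s * (s - 1) * ((4 * s - 2) * Complex.Gamma s * riemannZeta (2 * s - 1) -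
      1 / (s - 1) - 1 / (6 * s)) := by
  have hs1' : s - 1 ≠ 0 := sub_ne_zero.2 hs1
  have argument_ne : 2 * s - 1 ≠ 1 := fun h => hs1 (by linear_combination h / 2)
  rw [mellinNumerator, subOneMulZeta_of_ne argument_ne, Complex.Gamma_add_one s hs0]
  field_simp
  ring

theorem differentiableAt_mellinNumerator {s : ℂ} (hs : -1 < s.re) :
    DifferentiableAt ℂ mellinNumerator s := by
  have gamma_differentiable : DifferentiableAt ℂ (fun s => Complex.Gamma (s + 1)) s := by
    refine DifferentiableAt.comp (f := fun s : ℂ => s + 1) s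
      (Complex.differentiableAt_Gamma _ fun m hm => ?_) (by fun_prop)
    have : s.re + 1 = -m := by simpa using congrArg Complex.re hm
    linarith [m.cast_nonneg (α := ℝ)]
  have zeta_differentiable : DifferentiableAt ℂ (fun s => subOneMulZeta (2 * s - 1)) s :=
    DifferentiableAt.comp (f := fun s : ℂ => 2 * s - 1) s (differentiable_subOneMulZeta _)
      (by fun_prop)
  unfold mellinNumerator
  fun_prop

theorem mul_mellin_branchSumReg {s : ℂ} (hs1 : -1 < s.re) (hs2 : s.re < 2) :
    s * (s - 1) * mellin branchSumReg s = mellinNumerator s := by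
  have isOpen_strip (a b : ℝ) : IsOpen (Complex.re ⁻¹' Ioo a b) :=
    isOpen_Ioo.preimage Complex.continuous_re
  have strip_convex : Convex ℝ (Complex.re ⁻¹' Ioo (-1 : ℝ) 2) :=
    (convex_Ioo (-1 : ℝ) 2).linear_preimage Complex.reLm
  have left_analytic := DifferentiableOn.analyticOnNhd
    (fun z hz => ((differentiableAt_id.mul (differentiableAt_id.sub_const 1)).mul
      (differentiableAt_mellin_branchSumReg hz.1 hz.2)).differentiableWithinAt)
    (isOpen_strip (-1) 2)
  have right_analytic := DifferentiableOn.analyticOnNhd (fun z hz =>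
    (differentiableAt_mellinNumerator hz.1).differentiableWithinAt) (isOpen_strip (-1) 2)
  refine left_analytic.eqOn_of_preconnected_of_eventuallyEq right_analytic
    strip_convex.isPreconnected (z₀ := 3 / 2) (by norm_num) ?_ ⟨hs1, hs2⟩
  filter_upwards [(isOpen_strip 1 2).mem_nhds (by norm_num)] with z hz
  have hz0 : z ≠ 0 := fun h => by norm_num [h] at hz
  have hz1 : z ≠ 1 := fun h => by norm_num [h] at hz
  simp only [Pi.mul_apply, id, mellinNumerator_of_ne hz0 hz1,
    mellin_branchSumReg_of_one_lt_re hz.1 hz.2]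

theorem mellin_branchSumReg {s : ℂ} (hs1 : -1 < s.re) (hs2 : s.re < 2) (hs_ne0 : s ≠ 0)
    (hs_ne1 : s ≠ 1) :
    mellin branchSumReg s = (4 * s - 2) * Complex.Gamma s * riemannZeta (2 * s - 1) -
      1 / (s - 1) - 1 / (6 * s) := by
  apply mul_left_cancel₀ (mul_ne_zero hs_ne0 (sub_ne_zero.2 hs_ne1))
  rw [mul_mellin_branchSumReg hs1 hs2, mellinNumerator_of_ne hs_ne0 hs_ne1]

theorem hasDerivAt_mellinNumerator_zero :
    HasDerivAt mellinNumerator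
      (-(2 / 3 - Real.eulerMascheroniConstant / 6 - 4 * deriv riemannZeta (-1))) 0 := by
  have prefactor : HasDerivAt (fun s : ℂ => 4 * s - 2) 4 0 := by
    simpa using ((hasDerivAt_id (0 : ℂ)).const_mul 4).sub_const 2
  have argument : HasDerivAt (fun s : ℂ => 2 * s - 1) 2 0 := by
    simpa using ((hasDerivAt_id (0 : ℂ)).const_mul 2).sub_const 1
  have gamma : HasDerivAt (fun s : ℂ => Complex.Gamma (s + 1))
      (-Real.eulerMascheroniConstant) 0 :=
    HasDerivAt.comp_add_const 0 1 (by rw [zero_add]; exact Complex.hasDerivAt_Gamma_one)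
  have zeta : HasDerivAt (fun s : ℂ => subOneMulZeta (2 * s - 1))
      ((-1 / 12 + (-1 - 1) * deriv riemannZeta (-1)) * 2) 0 := by
    have at_neg_one := hasDerivAt_subOneMulZeta (w := -1) (by norm_num)
    rw [riemannZeta_neg_one] at at_neg_one
    exact at_neg_one.comp_of_eq 0 argument (by norm_num)
  have total := (((prefactor.mul gamma).mul (zeta.div_const 2)).sub
    (hasDerivAt_id (0 : ℂ))).sub (((hasDerivAt_id (0 : ℂ)).sub_const 1).div_const 6)
  refine total.congr_deriv ?_
  have value_at_zero : subOneMulZeta (2 * 0 - 1) = 1 / 6 := by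
    rw [mul_zero, zero_sub, subOneMulZeta_of_ne (by norm_num), riemannZeta_neg_one]
    norm_num
  rw [Pi.mul_apply, value_at_zero, zero_add, Complex.Gamma_one]
  ring

theorem mellin_branchSumReg_zero :
    mellin branchSumReg 0 =
      2 / 3 - Real.eulerMascheroniConstant / 6 - 4 * deriv riemannZeta (-1) := by
  have product_deriv :
      HasDerivAt (fun s => s * (s - 1) * mellin branchSumReg s) (-mellin branchSumReg 0) 0 := by
    have mellin_deriv :=
      (differentiableAt_mellin_branchSumReg (s := 0) (by simp) (by simp)).hasDerivAt
    refine (((hasDerivAt_id (0 : ℂ)).mul ((hasDerivAt_id (0 : ℂ)).sub_const 1)).mul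
      mellin_deriv).congr_deriv ?_
    simp
  have near_zero : mellinNumerator =ᶠ[𝓝 0] fun s => s * (s - 1) * mellin branchSumReg s := by
    filter_upwards [(isOpen_Ioo.preimage Complex.continuous_re).mem_nhds
      (show (0 : ℂ) ∈ Complex.re ⁻¹' Ioo (-1 : ℝ) 2 by simp)] with s hs
    exact (mul_mellin_branchSumReg hs.1 hs.2).symm
  have := hasDerivAt_mellinNumerator_zero.unique (product_deriv.congr_of_eventuallyEq near_zero)
  exact (neg_injective this).symm

/-! ### The periodic fluctuation -/

/-- The value of `branchSum` at `4 ^ (r - x)`, minus the singular part `4 ^ (x - r) + 1 / 6` when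
`r ≤ 0`; the subtraction makes the sum over all integers `r` converge. -/
noncomputable def branchTerm (r : ℤ) (x : ℝ) : ℝ :=
  branchSum ((4 : ℝ) ^ ((r : ℝ) - x)) - if r ≤ 0 then (4 : ℝ) ^ (x - r) + 1 / 6 else 0

theorem summable_quarter_pow_natAbs : Summable fun r : ℤ => (1 / 4 : ℝ) ^ r.natAbs := by
  have geometric : Summable fun n : ℕ => (1 / 4 : ℝ) ^ n :=
    summable_geometric_of_lt_one (by norm_num) (by norm_num)
  refine summable_int_iff_summable_nat_and_neg.2 ⟨?_, ?_⟩ <;> simpa using geometric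

theorem exists_abs_branchTerm_le_of_nonpos : ∃ C : ℝ, 0 ≤ C ∧ ∀ r : ℤ, r ≤ 0 → ∀ x : ℝ,
    |branchTerm r x| ≤ C * (4 : ℝ) ^ ((r : ℝ) - x) := by
  obtain ⟨C, hC, bound⟩ := exists_abs_branchSum_sub_le
  refine ⟨C, hC, fun r hr x => ?_⟩
  have inv_eq : (4 : ℝ) ^ (x - r) = 1 / (4 : ℝ) ^ ((r : ℝ) - x) := by
    rw [one_div, ← Real.rpow_neg (by norm_num), neg_sub]
  rw [branchTerm, if_pos hr, inv_eq, ← sub_sub]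
  exact bound _ (by positivity)

theorem exists_abs_branchTerm_le_of_pos : ∃ C : ℝ, 0 ≤ C ∧ ∀ r : ℤ, 0 < r → ∀ x : ℝ,
    |branchTerm r x| ≤ C * (4 : ℝ) ^ (2 * (x - r)) := by
  obtain ⟨C, hC, bound⟩ := exists_abs_branchSum_le
  refine ⟨C, hC, fun r hr x => ?_⟩
  rw [branchTerm, if_neg hr.not_ge, sub_zero]
  refine (bound _ (by positivity)).trans_eq ?_
  rw [div_eq_mul_inv, ← Real.rpow_natCast, ← Real.rpow_mul (by norm_num),
    ← Real.rpow_neg (by norm_num)]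
  push_cast
  ring_nf

theorem quarter_pow_natAbs (r : ℤ) : (1 / 4 : ℝ) ^ r.natAbs = (4 : ℝ) ^ (-|(r : ℝ)|) := by
  rw [Real.rpow_neg (by norm_num), ← Int.cast_abs, Int.abs_eq_natAbs, Int.cast_natCast,
    Real.rpow_natCast, one_div, inv_pow]

theorem exists_abs_branchTerm_le : ∃ C : ℝ, 0 ≤ C ∧ ∀ (r : ℤ) (x : ℝ),
    |branchTerm r x| ≤ C * (4 : ℝ) ^ (2 * |x|) * (1 / 4 : ℝ) ^ r.natAbs := by
  obtain ⟨C, hC, bound_nonpos⟩ := exists_abs_branchTerm_le_of_nonpos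
  obtain ⟨D, hD, bound_pos⟩ := exists_abs_branchTerm_le_of_pos
  refine ⟨C + D, by positivity, fun r x => ?_⟩
  rw [quarter_pow_natAbs, mul_assoc, ← Real.rpow_add (by norm_num)]
  rcases le_or_gt r 0 with hr | hr
  · have hr' : (r : ℝ) ≤ 0 := by exact_mod_cast hr
    refine (bound_nonpos r hr x).trans ?_
    gcongr
    · linarith
    · norm_num
    · rw [abs_of_nonpos hr']
      linarith [neg_abs_le x, abs_nonneg x]
  · have hr' : (0 : ℝ) < r := by exact_mod_cast hr
    refine (bound_pos r hr x).trans ?_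
    gcongr
    · linarith
    · norm_num
    · rw [abs_of_pos hr']
      linarith [le_abs_self x]

theorem summable_branchTerm (x : ℝ) : Summable fun r : ℤ => branchTerm r x := by
  obtain ⟨C, _, bound⟩ := exists_abs_branchTerm_le
  exact Summable.of_norm_bounded (summable_quarter_pow_natAbs.mul_left _) fun r => bound r x

theorem continuous_branchTerm (r : ℤ) : Continuous (branchTerm r) := by
  have continuous_four_rpow {g : ℝ → ℝ} (hg : Continuous g) : Continuous fun x => (4 : ℝ) ^ g x :=
    continuous_const.rpow hg fun _ => Or.inl (by norm_num)
  have continuous_main : Continuous fun x : ℝ => branchSum ((4 : ℝ) ^ ((r : ℝ) - x)) :=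
    continuousOn_branchSum.comp_continuous (continuous_four_rpow (by fun_prop)) fun x =>
      Real.rpow_pos_of_pos (by norm_num) _
  unfold branchTerm
  refine continuous_main.sub ?_
  split_ifs
  · exact (continuous_four_rpow (by fun_prop)).add_const _
  · exact continuous_const

/-- The two-sided sum over `r` of `branchSum (4 ^ (r - x))`, with the singular parts removed for
`r ≤ 0`. -/
noncomputable def branchTotal (x : ℝ) : ℝ := ∑' r : ℤ, branchTerm r x

theorem continuous_branchTotal : Continuous branchTotal := by
  obtain ⟨C, hC, bound⟩ := exists_abs_branchTerm_le
  refine continuous_iff_continuousAt.2 fun x₀ => ?_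
  have continuousOn_nhds : ContinuousOn branchTotal (Ioo (-(|x₀| + 1)) (|x₀| + 1)) := by
    refine continuousOn_tsum (u := fun r : ℤ => C * (4 : ℝ) ^ (2 * (|x₀| + 1)) *
      (1 / 4 : ℝ) ^ r.natAbs) (fun r => (continuous_branchTerm r).continuousOn)
      (summable_quarter_pow_natAbs.mul_left _) fun r x hx => (bound r x).trans ?_
    gcongr
    · norm_num
    · exact abs_le.2 ⟨hx.1.le, hx.2.le⟩
  refine continuousOn_nhds.continuousAt (Ioo_mem_nhds ?_ ?_)
  · linarith [neg_abs_le x₀]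
  · linarith [le_abs_self x₀]

theorem branchTerm_add_one (r : ℤ) (x : ℝ) :
    branchTerm (r + 1) (x + 1) = branchTerm r x + if r = 0 then (4 : ℝ) ^ x + 1 / 6 else 0 := by
  rw [branchTerm, branchTerm]
  push_cast
  rw [add_sub_add_right_eq_sub, add_sub_add_right_eq_sub]
  rcases lt_trichotomy r 0 with hr | rfl | hr
  · rw [if_pos (by omega), if_pos (by omega), if_neg hr.ne, add_zero]
  · simp
  · rw [if_neg (by omega), if_neg (by omega), if_neg hr.ne', add_zero]

theorem branchTotal_add_one (x : ℝ) :
    branchTotal (x + 1) = branchTotal x + ((4 : ℝ) ^ x + 1 / 6) := by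
  rw [branchTotal, ← (Equiv.addRight (1 : ℤ)).tsum_eq]
  simp only [Equiv.coe_addRight, branchTerm_add_one]
  rw [(summable_branchTerm x).tsum_add
    (summable_of_ne_finset_zero (s := {0}) fun r hr => if_neg (Finset.notMem_singleton.1 hr)),
    tsum_ite_eq, branchTotal]

/-- The function `branchTotal` minus its non-periodic part. It has period `1`, and differs from
`delta` by its mean value. -/
noncomputable def fluctuation (x : ℝ) : ℝ := branchTotal x - (4 : ℝ) ^ x / 3 - x / 6

theorem periodic_fluctuation : Function.Periodic fluctuation 1 := by
  intro x
  rw [fluctuation, fluctuation, branchTotal_add_one, Real.rpow_add_one (by norm_num)]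
  ring

theorem continuous_fluctuation : Continuous fluctuation :=
  (continuous_branchTotal.sub ((continuous_const.rpow continuous_id fun _ =>
    Or.inl (by norm_num)).div_const 3)).sub (continuous_id.div_const 6)

theorem log_four : Real.log 4 = 2 * Real.log 2 := by
  rw [show (4 : ℝ) = 2 ^ 2 by norm_num, Real.log_pow, Nat.cast_two]

theorem log_four_pos : 0 < Real.log 4 := Real.log_pos (by norm_num)

theorem chi_div_two_mul_log_four (k : ℤ) :
    chi k / 2 * Real.log 4 = 2 * Real.pi * Complex.I * k := by
  have log_two_ne : (Real.log 2 : ℂ) ≠ 0 :=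
    Complex.ofReal_ne_zero.2 (Real.log_pos one_lt_two).ne'
  rw [chi, log_four]
  push_cast
  field_simp

theorem chi_eq (k : ℤ) : chi k = ((2 * Real.pi * k / Real.log 2 : ℝ) : ℂ) * Complex.I := by
  rw [chi]
  push_cast
  ring

theorem re_chi_div_two (k : ℤ) : (chi k / 2).re = 0 := by
  rw [chi_eq, Complex.div_ofNat_re, Complex.re_ofReal_mul, Complex.I_re, mul_zero, zero_div]

section MellinSubstitution

variable {E : Type*} [NormedAddCommGroup E] [NormedSpace ℂ E] {b : ℝ}

theorem hasDerivAt_const_rpow_neg (hb : 0 < b) (y : ℝ) :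
    HasDerivAt (fun y : ℝ => b ^ (-y)) (-Real.log b * b ^ (-y)) y :=
  ((hasDerivAt_neg y).const_rpow hb).congr_deriv (by ring)

theorem injective_const_rpow_neg (hb : 1 < b) : Function.Injective fun y : ℝ => b ^ (-y) :=
  fun _ _ h => neg_injective
    ((Real.rpow_right_inj (one_pos.trans hb) hb.ne').1 h)

theorem image_const_rpow_neg_univ (hb : 1 < b) : (fun y : ℝ => b ^ (-y)) '' univ = Ioi 0 := by
  have hb0 : 0 < b := one_pos.trans hb
  rw [image_univ]
  refine Subset.antisymm (range_subset_iff.2 fun y => Real.rpow_pos_of_pos hb0 _) fun t ht => ?_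
  exact ⟨-Real.logb b t, by simp only [neg_neg]; exact Real.rpow_logb hb0 hb.ne' ht⟩

theorem abs_deriv_smul_mellin_integrand (hb : 1 < b) (f : ℝ → E) (s : ℂ) (y : ℝ) :
    |-Real.log b * b ^ (-y)| • (((b ^ (-y) : ℝ) : ℂ) ^ (s - 1) • f (b ^ (-y))) =
      (Real.log b : ℂ) • (Complex.exp (-(s * Real.log b * y)) • f (b ^ (-y))) := by
  have hb0 : 0 < b := one_pos.trans hb
  have hpos : 0 < b ^ (-y) := Real.rpow_pos_of_pos hb0 _
  have hne : ((b ^ (-y) : ℝ) : ℂ) ≠ 0 := Complex.ofReal_ne_zero.2 hpos.ne'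
  have cpow_eq : ((b ^ (-y) : ℝ) : ℂ) ^ s = Complex.exp (-(s * Real.log b * y)) := by
    rw [Complex.cpow_def_of_ne_zero hne, ← Complex.ofReal_log hpos.le, Real.log_rpow hb0]
    push_cast
    ring_nf
  rw [neg_mul, abs_neg, abs_of_pos (mul_pos (Real.log_pos hb) hpos), ← Complex.coe_smul, smul_smul,
    smul_smul, Complex.cpow_sub _ _ hne, Complex.cpow_one, cpow_eq]
  congr 1
  push_cast at hne ⊢
  field_simp

theorem integrable_exp_smul_of_mellinConvergent (hb : 1 < b) {f : ℝ → E} {s : ℂ}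
    (hf : MellinConvergent f s) :
    Integrable fun y : ℝ => Complex.exp (-(s * Real.log b * y)) • f (b ^ (-y)) := by
  rw [MellinConvergent, ← image_const_rpow_neg_univ hb,
    integrableOn_image_iff_integrableOn_abs_deriv_smul MeasurableSet.univ
      (fun y _ => (hasDerivAt_const_rpow_neg (one_pos.trans hb) y).hasDerivWithinAt)
      (injective_const_rpow_neg hb).injOn, integrableOn_univ] at hf
  simp_rw [abs_deriv_smul_mellin_integrand hb] at hf
  exact (integrable_smul_iff (Complex.ofReal_ne_zero.2 (Real.log_pos hb).ne') _).1 hf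

theorem mellin_eq_log_smul_integral (hb : 1 < b) (f : ℝ → E) (s : ℂ) :
    mellin f s =
      (Real.log b : ℂ) • ∫ y : ℝ, Complex.exp (-(s * Real.log b * y)) • f (b ^ (-y)) := by
  rw [mellin, ← image_const_rpow_neg_univ hb,
    integral_image_eq_integral_abs_deriv_smul MeasurableSet.univ
      (fun y _ => (hasDerivAt_const_rpow_neg (one_pos.trans hb) y).hasDerivWithinAt)
      (injective_const_rpow_neg hb).injOn, setIntegral_univ]
  simp_rw [abs_deriv_smul_mellin_integrand hb]
  exact integral_smul _ _

end MellinSubstitution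

theorem fourier_neg_coe (k : ℤ) (x : ℝ) :
    fourier (-k) (x : UnitAddCircle) = Complex.exp (-(2 * Real.pi * Complex.I * k * x)) := by
  rw [fourier_coe_apply]
  congr 1
  push_cast
  ring

theorem continuous_fourier_coe (k : ℤ) : Continuous fun x : ℝ => fourier k (x : UnitAddCircle) :=
  (fourier k).continuous.comp (AddCircle.continuous_mk' 1)

theorem hasSum_integral_fourier_mul_branchTerm (k : ℤ) :
    HasSum (fun r : ℤ => ∫ x in (0 : ℝ)..1, fourier (-k) (x : UnitAddCircle) * branchTerm r x)
      (∫ x in (0 : ℝ)..1, fourier (-k) (x : UnitAddCircle) * branchTotal x) := by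
  obtain ⟨C, hC, bound⟩ := exists_abs_branchTerm_le
  refine intervalIntegral.hasSum_integral_of_dominated_convergence
    (fun r _ => C * (4 : ℝ) ^ (2 * (1 : ℝ)) * (1 / 4 : ℝ) ^ r.natAbs) (fun r => ?_)
    (fun r => Eventually.of_forall fun x hx => ?_)
    (Eventually.of_forall fun x _ => summable_quarter_pow_natAbs.mul_left _)
    intervalIntegrable_const (Eventually.of_forall fun x _ => ?_)
  · exact ((continuous_fourier_coe (-k)).mul
      (Complex.continuous_ofReal.comp (continuous_branchTerm r))).aestronglyMeasurable
  · rw [uIoc_of_le zero_le_one] at hx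
    rw [norm_mul, fourier_apply, Circle.norm_coe, one_mul, Complex.norm_real]
    refine (bound r x).trans ?_
    gcongr
    · norm_num
    · exact abs_le.2 ⟨by linarith [hx.1], hx.2⟩
  · exact (Complex.hasSum_ofReal.2 (summable_branchTerm x).hasSum).mul_left _

theorem branchSumReg_four_rpow (r : ℤ) {x : ℝ} (hx0 : 0 < x) (hx1 : x < 1) :
    branchSumReg ((4 : ℝ) ^ ((r : ℝ) - x)) = (branchTerm r x : ℂ) := by
  rcases le_or_gt r 0 with hr | hr
  · have hr' : (r : ℝ) ≤ 0 := by exact_mod_cast hr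
    rw [branchSumReg_of_le (by positivity)
      (Real.rpow_le_one_of_one_le_of_nonpos (by norm_num) (by linarith)), branchTerm, if_pos hr,
      ← neg_sub (r : ℝ) x, Real.rpow_neg (by norm_num), one_div, sub_sub]
  · have hr' : (1 : ℝ) ≤ r := by exact_mod_cast hr
    rw [branchSumReg_of_lt (Real.one_lt_rpow (by norm_num) (by linarith)), branchTerm,
      if_neg hr.not_ge, sub_zero]

theorem integral_fourier_mul_branchTerm (k r : ℤ) :
    ∫ x in (0 : ℝ)..1, fourier (-k) (x : UnitAddCircle) * branchTerm r x =
      ∫ x in (0 : ℝ)..1, fourier (-k) ((x + (-r : ℤ) : ℝ) : UnitAddCircle) *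
        branchSumReg ((4 : ℝ) ^ (-(x + (-r : ℤ)))) := by
  refine intervalIntegral.integral_congr_ae ?_
  filter_upwards [compl_mem_ae_iff.2 (measure_singleton (1 : ℝ))] with x hx1 hx
  rw [uIoc_of_le zero_le_one] at hx
  have coe_eq : ((x + (-r : ℤ) : ℝ) : UnitAddCircle) = x := by simp
  rw [coe_eq, ← branchSumReg_four_rpow r hx.1 (lt_of_le_of_ne hx.2 hx1), Int.cast_neg,
    ← sub_eq_add_neg, neg_sub]

theorem integral_fourier_mul_branchTotal (k : ℤ) :
    ∫ x in (0 : ℝ)..1, fourier (-k) (x : UnitAddCircle) * branchTotal x =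
      mellin branchSumReg (chi k / 2) / Real.log 4 := by
  have kernel_eq (y : ℝ) : Complex.exp (-(chi k / 2 * Real.log 4 * y)) •
      branchSumReg ((4 : ℝ) ^ (-y)) =
      fourier (-k) (y : UnitAddCircle) * branchSumReg ((4 : ℝ) ^ (-y)) := by
    rw [chi_div_two_mul_log_four, fourier_neg_coe, smul_eq_mul]
  have integrable := integrable_exp_smul_of_mellinConvergent (b := 4) (by norm_num)
    (mellinConvergent_branchSumReg (s := chi k / 2) (by rw [re_chi_div_two]; norm_num)
      (by rw [re_chi_div_two]; norm_num))
  simp only [kernel_eq] at integrable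
  have unfolded := integrable.hasSum_intervalIntegral_comp_add_int
  rw [← (Equiv.neg ℤ).hasSum_iff] at unfolded
  rw [mellin_eq_log_smul_integral (b := 4) (by norm_num), smul_eq_mul,
    mul_div_cancel_left₀ _ (Complex.ofReal_ne_zero.2 log_four_pos.ne')]
  simp only [kernel_eq]
  exact (hasSum_integral_fourier_mul_branchTerm k).unique
    (unfolded.congr_fun fun r => integral_fourier_mul_branchTerm k r)

theorem integral_fourier_mul_four_rpow (k : ℤ) :
    ∫ x in (0 : ℝ)..1, fourier (-k) (x : UnitAddCircle) * (((4 : ℝ) ^ x : ℝ) : ℂ) =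
      3 / (Real.log 4 * (1 - chi k / 2)) := by
  have log_ne : (Real.log 4 : ℂ) ≠ 0 := Complex.ofReal_ne_zero.2 log_four_pos.ne'
  have one_sub_ne : 1 - chi k / 2 ≠ 0 := by
    intro h
    simpa [re_chi_div_two, -Complex.div_ofNat_re] using congrArg Complex.re h
  have integrand_eq (x : ℝ) : fourier (-k) (x : UnitAddCircle) * (((4 : ℝ) ^ x : ℝ) : ℂ) =
      Complex.exp (Real.log 4 * (1 - chi k / 2) * x) := by
    rw [fourier_neg_coe, Real.rpow_def_of_pos (by norm_num), Complex.ofReal_exp, ← Complex.exp_add]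
    congr 1
    push_cast
    linear_combination (x : ℂ) * chi_div_two_mul_log_four k
  have value_at_one : Complex.exp (Real.log 4 * (1 - chi k / 2) * (1 : ℝ)) = 4 := by
    rw [← integrand_eq 1, AddCircle.coe_period]
    simp
  simp_rw [integrand_eq]
  rw [integral_exp_mul_complex (mul_ne_zero log_ne one_sub_ne), value_at_one, Complex.ofReal_zero,
    mul_zero, Complex.exp_zero]
  norm_num

theorem integral_fourier_mul_self {k : ℤ} (hk : k ≠ 0) :
    ∫ x in (0 : ℝ)..1, fourier (-k) (x : UnitAddCircle) * (x : ℂ) =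
      -1 / (2 * Real.pi * Complex.I * k) := by
  have hk' : (2 * Real.pi * Complex.I * k : ℂ) ≠ 0 :=
    mul_ne_zero Complex.two_pi_I_ne_zero (Int.cast_ne_zero.2 hk)
  have exp_neg_eq_one : Complex.exp (-(2 * Real.pi * Complex.I * k)) = 1 :=
    Complex.exp_eq_one_iff.2 ⟨-k, by push_cast; ring⟩
  simp_rw [fourier_neg_coe]
  generalize (2 * Real.pi * Complex.I * k : ℂ) = a at *
  have primitive : ∀ x ∈ uIcc (0 : ℝ) 1, HasDerivAt
      (fun x : ℝ => -((x : ℂ) / a + 1 / a ^ 2) * Complex.exp (-(a * x)))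
      (Complex.exp (-(a * x)) * (x : ℂ)) x := by
    intro x _
    have id_deriv : HasDerivAt (fun x : ℝ => (x : ℂ)) 1 x := Complex.ofRealCLM.hasDerivAt
    refine (((id_deriv.div_const a).add_const (1 / a ^ 2)).neg.mul
      (id_deriv.const_mul a).neg.cexp).congr_deriv ?_
    simp only [Pi.neg_apply]
    field_simp
    ring
  rw [intervalIntegral.integral_eq_sub_of_hasDerivAt primitive
    ((by fun_prop : Continuous fun x : ℝ =>
      Complex.exp (-(a * x)) * (x : ℂ)).intervalIntegrable _ _), Complex.ofReal_one, mul_one,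
    exp_neg_eq_one, Complex.ofReal_zero, mul_zero, neg_zero, Complex.exp_zero]
  field_simp
  ring

/-! ### Decay of the Fourier coefficients -/

theorem norm_Gamma_mul_I_sq_mul {y : ℝ} (hy : y ≠ 0) :
    ‖Complex.Gamma (y * Complex.I)‖ ^ 2 * (|y| * |Real.sinh (Real.pi * y)|) = Real.pi := by
  have mul_I_ne : -((y : ℂ) * Complex.I) ≠ 0 := by simp [hy]
  have Gamma_one_sub : Complex.Gamma (1 - y * Complex.I) = -(y * Complex.I) *
      (starRingEnd ℂ) (Complex.Gamma (y * Complex.I)) := by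
    rw [← Complex.Gamma_conj, map_mul, Complex.conj_I, Complex.conj_ofReal, sub_eq_neg_add,
      Complex.Gamma_add_one _ mul_I_ne, mul_neg]
  have sin_mul_I :
      Complex.sin (Real.pi * (y * Complex.I)) = (Real.sinh (Real.pi * y) : ℝ) * Complex.I := by
    rw [← mul_assoc, Complex.sin_mul_I, Complex.ofReal_sinh, Complex.ofReal_mul]
  have sinh_ne : Real.sinh (Real.pi * y) ≠ 0 :=
    Real.sinh_ne_zero.2 (mul_ne_zero Real.pi_ne_zero hy)
  have reflection := congrArg norm (Complex.Gamma_mul_Gamma_one_sub (y * Complex.I))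
  rw [Gamma_one_sub, sin_mul_I] at reflection
  simp only [norm_mul, norm_div, norm_neg, Complex.norm_I, Complex.norm_conj, Complex.norm_real,
    Real.norm_eq_abs, mul_one, abs_of_pos Real.pi_pos, eq_div_iff (abs_ne_zero.2 sinh_ne)]
    at reflection
  linarith

theorem exp_div_four_le_abs_sinh {x : ℝ} (hx : 1 ≤ |x|) : Real.exp |x| / 4 ≤ |Real.sinh x| := by
  have exp_neg_le_one : Real.exp (-|x|) ≤ 1 := Real.exp_le_one_iff.2 (by linarith)
  have two_le_exp : |x| + 1 ≤ Real.exp |x| := Real.add_one_le_exp _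
  rw [Real.abs_sinh, Real.sinh_eq]
  linarith

theorem norm_Gamma_mul_I_le {y : ℝ} (hy : 1 ≤ |y|) :
    ‖Complex.Gamma (y * Complex.I)‖ ≤ 4 * Real.exp (-(Real.pi * |y| / 2)) := by
  have sinh_ge : Real.exp (Real.pi * |y|) / 4 ≤ |Real.sinh (Real.pi * y)| := by
    have abs_mul_pi : |Real.pi * y| = Real.pi * |y| := by rw [abs_mul, abs_of_pos Real.pi_pos]
    rw [← abs_mul_pi]
    exact exp_div_four_le_abs_sinh (by rw [abs_mul_pi]; nlinarith [Real.pi_gt_three])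
  refine le_of_sq_le_sq ?_ (by positivity)
  calc ‖Complex.Gamma (y * Complex.I)‖ ^ 2
      = ‖Complex.Gamma (y * Complex.I)‖ ^ 2 * (1 * (Real.exp (Real.pi * |y|) / 4)) *
          (4 * Real.exp (-(Real.pi * |y|))) := by
        rw [Real.exp_neg]
        field_simp
    _ ≤ ‖Complex.Gamma (y * Complex.I)‖ ^ 2 * (|y| * |Real.sinh (Real.pi * y)|) *
          (4 * Real.exp (-(Real.pi * |y|))) := by gcongr
    _ = Real.pi * (4 * Real.exp (-(Real.pi * |y|))) := by
        rw [norm_Gamma_mul_I_sq_mul (abs_pos.1 (by linarith))]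
    _ ≤ 4 * (4 * Real.exp (-(Real.pi * |y|))) := by
        gcongr
        exact Real.pi_lt_four.le
    _ = (4 * Real.exp (-(Real.pi * |y| / 2))) ^ 2 := by
        rw [mul_pow, ← Real.exp_nat_mul, Nat.cast_two, mul_neg, mul_div_cancel₀ _ two_ne_zero]
        ring

theorem norm_Gamma_two_sub_mul_I_le {y : ℝ} (hy : 1 ≤ |y|) :
    ‖Complex.Gamma (2 - y * Complex.I)‖ ≤ 8 * |y| ^ 2 * Real.exp (-(Real.pi * |y| / 2)) := by
  have hy0 : y ≠ 0 := abs_pos.1 (by linarith)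
  have mul_I_ne : ((-y : ℝ) : ℂ) * Complex.I ≠ 0 := by simp [hy0]
  have mul_I_add_one_ne : ((-y : ℝ) : ℂ) * Complex.I + 1 ≠ 0 := fun h =>
    hy0 (by simpa using congrArg Complex.im h)
  have norm_mul_I : ‖((-y : ℝ) : ℂ) * Complex.I‖ = |y| := by
    rw [norm_mul, Complex.norm_I, Complex.norm_real, mul_one, Real.norm_eq_abs, abs_neg]
  have norm_mul_I_add_one_le : ‖((-y : ℝ) : ℂ) * Complex.I + 1‖ ≤ 2 * |y| := by
    refine (norm_add_le _ _).trans ?_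
    rw [norm_mul_I, norm_one]
    linarith
  have Gamma_le := norm_Gamma_mul_I_le (y := -y) (by rwa [abs_neg])
  rw [abs_neg] at Gamma_le
  rw [show (2 : ℂ) - y * Complex.I = ((-y : ℝ) : ℂ) * Complex.I + 1 + 1 by push_cast; ring,
    Complex.Gamma_add_one _ mul_I_add_one_ne, Complex.Gamma_add_one _ mul_I_ne, norm_mul, norm_mul,
    norm_mul_I]
  calc _ ≤ 2 * |y| * (|y| * (4 * Real.exp (-(Real.pi * |y| / 2)))) := by gcongr
    _ = _ := by ring

theorem norm_cos_le (z : ℂ) : ‖Complex.cos z‖ ≤ Real.exp |z.im| := by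
  have norm_exp_le : ‖Complex.exp (z * Complex.I)‖ ≤ Real.exp |z.im| := by
    rw [Complex.norm_exp]
    exact Real.exp_le_exp.2 (by simpa using neg_le_abs z.im)
  have norm_exp_neg_le : ‖Complex.exp (-z * Complex.I)‖ ≤ Real.exp |z.im| := by
    rw [Complex.norm_exp]
    exact Real.exp_le_exp.2 (by simpa using le_abs_self z.im)
  rw [Complex.cos, norm_div, Complex.norm_two, div_le_iff₀ two_pos]
  linarith [norm_add_le (Complex.exp (z * Complex.I)) (Complex.exp (-z * Complex.I))]

theorem norm_riemannZeta_le_tsum {s : ℂ} (hs : 1 < s.re) :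
    ‖riemannZeta s‖ ≤ ∑' n : ℕ, 1 / (n : ℝ) ^ s.re := by
  rw [zeta_eq_tsum_one_div_nat_cpow hs]
  refine tsum_of_norm_bounded (Real.summable_one_div_nat_rpow.2 hs).hasSum fun n => ?_
  rw [norm_div, norm_one, Complex.norm_natCast_cpow_of_re_ne_zero _ (by linarith)]

theorem norm_riemannZeta_two_sub_mul_I_le (y : ℝ) : ‖riemannZeta (2 - y * Complex.I)‖ ≤ 2 := by
  have re_eq : (2 - y * Complex.I).re = 2 := by simp
  refine (norm_riemannZeta_le_tsum (by rw [re_eq]; norm_num)).trans ?_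
  simp only [re_eq, Real.rpow_two, hasSum_zeta_two.tsum_eq]
  nlinarith [Real.pi_pos, Real.pi_lt_d2]

theorem norm_riemannZeta_mul_I_sub_one_le {y : ℝ} (hy : 1 ≤ |y|) :
    ‖riemannZeta (y * Complex.I - 1)‖ ≤ 32 * |y| ^ 2 := by
  have ne_real (a : ℂ) (ha : a.im = 0) : 2 - y * Complex.I ≠ a := by
    rintro rfl
    exact abs_pos.1 (one_pos.trans_le hy) (by simpa using ha)
  have cos_le : ‖Complex.cos (Real.pi * (2 - y * Complex.I) / 2)‖ ≤
      Real.exp (Real.pi * |y| / 2) := by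
    refine (norm_cos_le _).trans_eq ?_
    simp [abs_div, abs_mul, abs_of_pos Real.pi_pos]
  have cpow_le : ‖(2 * Real.pi : ℂ) ^ (-(2 - y * Complex.I))‖ ≤ 1 := by
    rw [← Complex.ofReal_ofNat, ← Complex.ofReal_mul,
      Complex.norm_cpow_eq_rpow_re_of_pos (by positivity)]
    exact Real.rpow_le_one_of_one_le_of_nonpos (by linarith [Real.pi_gt_three]) (by simp)
  have functional_equation := riemannZeta_one_sub (s := 2 - y * Complex.I)
    (fun n => ne_real _ (by simp)) (ne_real _ (by simp))
  rw [show (y * Complex.I - 1 : ℂ) = 1 - (2 - y * Complex.I) by ring, functional_equation,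
    norm_mul, norm_mul, norm_mul, norm_mul, Complex.norm_two]
  calc _ ≤ 2 * 1 * (8 * |y| ^ 2 * Real.exp (-(Real.pi * |y| / 2))) *
      Real.exp (Real.pi * |y| / 2) * 2 := by
        gcongr
        exacts [norm_Gamma_two_sub_mul_I_le hy, norm_riemannZeta_two_sub_mul_I_le y]
    _ = 32 * |y| ^ 2 * (Real.exp (-(Real.pi * |y| / 2)) * Real.exp (Real.pi * |y| / 2)) := by ring
    _ = _ := by rw [← Real.exp_add, neg_add_cancel, Real.exp_zero, mul_one]

theorem norm_chi (k : ℤ) : ‖chi k‖ = 2 * Real.pi * |(k : ℝ)| / Real.log 2 := by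
  rw [chi_eq, norm_mul, Complex.norm_I, mul_one, Complex.norm_real, Real.norm_eq_abs, abs_div,
    abs_mul, abs_of_pos Real.two_pi_pos, abs_of_pos (Real.log_pos one_lt_two)]

theorem two_mul_abs_le_norm_chi (k : ℤ) : 2 * |(k : ℝ)| ≤ ‖chi k‖ := by
  rw [norm_chi, le_div_iff₀ (Real.log_pos one_lt_two)]
  have log_le_pi : Real.log 2 ≤ Real.pi := by linarith [Real.log_two_lt_d9, Real.pi_gt_three]
  calc 2 * |(k : ℝ)| * Real.log 2 ≤ 2 * |(k : ℝ)| * Real.pi := by gcongr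
    _ = _ := by ring

theorem pow_six_mul_exp_neg_le {u : ℝ} (hu : 0 ≤ u) :
    u ^ 6 * Real.exp (-(Real.pi * (u / 2) / 2)) ≤ 4 ^ 6 * 720 := by
  calc u ^ 6 * Real.exp (-(Real.pi * (u / 2) / 2)) ≤ u ^ 6 * Real.exp (-(u / 4)) := by
        gcongr ?_ * Real.exp (-?_)
        nlinarith [Real.pi_gt_three]
    _ = 4 ^ 6 * ((u / 4) ^ 6 * Real.exp (-(u / 4))) := by ring
    _ ≤ 4 ^ 6 * (Nat.factorial 6 : ℕ) := by
        gcongr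
        exact pow_mul_exp_neg_le (by positivity) 6
    _ = 4 ^ 6 * 720 := by norm_num [Nat.factorial]

theorem norm_deltaCoeff_le_exp {k : ℤ} (hk : k ≠ 0) :
    ‖deltaCoeff k‖ ≤ 1 / Real.log 2 *
      (256 * ‖chi k‖ ^ 3 * Real.exp (-(Real.pi * (‖chi k‖ / 2) / 2))) := by
  have one_le_abs : (1 : ℝ) ≤ |(k : ℝ)| := by exact_mod_cast Int.one_le_abs hk
  have two_le_norm_chi : 2 ≤ ‖chi k‖ := by linarith [two_mul_abs_le_norm_chi k]
  obtain ⟨y, chi_eq_mul_I⟩ : ∃ y : ℝ, chi k = y * Complex.I := ⟨_, chi_eq k⟩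
  have norm_chi_eq : ‖chi k‖ = |y| := by
    rw [chi_eq_mul_I, norm_mul, Complex.norm_I, mul_one, Complex.norm_real, Real.norm_eq_abs]
  have Gamma_le : ‖Complex.Gamma (chi k / 2)‖ ≤
      4 * Real.exp (-(Real.pi * (‖chi k‖ / 2) / 2)) := by
    have bound := norm_Gamma_mul_I_le (y := y / 2) (by rw [abs_div, abs_two]; linarith)
    rwa [abs_div, abs_two, ← norm_chi_eq, Complex.ofReal_div, Complex.ofReal_ofNat,
      div_mul_eq_mul_div, ← chi_eq_mul_I] at bound
  have zeta_le : ‖riemannZeta (chi k - 1)‖ ≤ 32 * ‖chi k‖ ^ 2 := by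
    have bound := norm_riemannZeta_mul_I_sub_one_le (y := y) (by linarith)
    rwa [← chi_eq_mul_I, ← norm_chi_eq] at bound
  have chi_sub_one_le : ‖chi k - 1‖ ≤ 2 * ‖chi k‖ := by
    refine (norm_sub_le _ _).trans ?_
    rw [norm_one]
    linarith
  have log_pos : 0 < Real.log 2 := Real.log_pos one_lt_two
  rw [deltaCoeff, norm_mul, norm_mul, norm_mul, norm_div, norm_one, Complex.norm_real,
    Real.norm_of_nonneg log_pos.le]
  calc _ ≤ 1 / Real.log 2 * (4 * Real.exp (-(Real.pi * (‖chi k‖ / 2) / 2)) * (32 * ‖chi k‖ ^ 2) *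
      (2 * ‖chi k‖)) := by gcongr
    _ = _ := by ring

theorem exists_norm_deltaCoeff_le : ∃ C : ℝ, 0 ≤ C ∧ ∀ k : ℤ, k ≠ 0 →
    ‖deltaCoeff k‖ ≤ C * |1 / (k : ℝ) ^ 3| := by
  have : 0 < Real.log 2 := Real.log_pos one_lt_two
  refine ⟨1 / Real.log 2 * (256 * (4 ^ 6 * 720)), by positivity, fun k hk => ?_⟩
  have abs_pos : 0 < |(k : ℝ)| := _root_.abs_pos.2 (Int.cast_ne_zero.2 hk)
  have abs_le_norm_chi : |(k : ℝ)| ≤ ‖chi k‖ := by linarith [two_mul_abs_le_norm_chi k]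
  rw [abs_div, abs_one, abs_pow, mul_one_div, le_div_iff₀ (by positivity)]
  calc ‖deltaCoeff k‖ * |(k : ℝ)| ^ 3
      ≤ 1 / Real.log 2 * (256 * ‖chi k‖ ^ 3 * Real.exp (-(Real.pi * (‖chi k‖ / 2) / 2))) *
          ‖chi k‖ ^ 3 := by
        gcongr
        exact norm_deltaCoeff_le_exp hk
    _ = 1 / Real.log 2 * (256 * (‖chi k‖ ^ 6 * Real.exp (-(Real.pi * (‖chi k‖ / 2) / 2)))) := by
        ring
    _ ≤ 1 / Real.log 2 * (256 * (4 ^ 6 * 720)) := by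
        gcongr 1 / Real.log 2 * (256 * ?_)
        exact pow_six_mul_exp_neg_le (norm_nonneg _)

theorem summable_abs_one_div_int_pow {p : ℕ} (hp : 1 < p) :
    Summable fun k : ℤ => |1 / (k : ℝ) ^ p| :=
  (Real.summable_one_div_int_pow.2 hp).abs

theorem summable_norm_deltaCoeff :
    Summable (fun k : {k : ℤ // k ≠ 0} => ‖deltaCoeff k‖) := by
  obtain ⟨C, -, bound⟩ := exists_norm_deltaCoeff_le
  exact Summable.of_nonneg_of_le (fun _ => norm_nonneg _) (fun k => bound k k.2)
    (((summable_abs_one_div_int_pow (by norm_num)).mul_left C).subtype _)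

/-! ### The Fourier series of the fluctuation -/

/-- The `1`-periodic function `fluctuation`, as a continuous complex-valued function on the
circle `ℝ / ℤ`, so that Fourier theory applies. -/
noncomputable def fluctuationCircle : C(UnitAddCircle, ℂ) where
  toFun := (periodic_fluctuation.comp ((↑) : ℝ → ℂ)).lift
  continuous_toFun := continuous_coinduced_dom.mpr
    (Complex.continuous_ofReal.comp continuous_fluctuation)

theorem fluctuationCircle_coe (x : ℝ) :
    fluctuationCircle (x : UnitAddCircle) = (fluctuation x : ℂ) := rfl

theorem fourierCoeff_fluctuationCircle (k : ℤ) : fourierCoeff fluctuationCircle k =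
    mellin branchSumReg (chi k / 2) / Real.log 4 - 1 / (Real.log 4 * (1 - chi k / 2)) -
      (∫ x in (0 : ℝ)..1, fourier (-k) (x : UnitAddCircle) * (x : ℂ)) / 6 := by
  have integrand_eq (x : ℝ) :
      fourier (-k) (x : UnitAddCircle) • fluctuationCircle (x : UnitAddCircle) =
        fourier (-k) (x : UnitAddCircle) * (branchTotal x : ℂ) -
        fourier (-k) (x : UnitAddCircle) * (((4 : ℝ) ^ x : ℝ) : ℂ) / 3 -
        fourier (-k) (x : UnitAddCircle) * (x : ℂ) / 6 := by
    rw [fluctuationCircle_coe, fluctuation, smul_eq_mul]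
    push_cast
    ring
  have integrable {f : ℝ → ℝ} (hf : Continuous f) : IntervalIntegrable
      (fun x : ℝ => fourier (-k) (x : UnitAddCircle) * (f x : ℂ)) volume 0 1 :=
    ((continuous_fourier_coe (-k)).mul
      (Complex.continuous_ofReal.comp hf)).intervalIntegrable _ _
  have integrable_branchTotal := integrable continuous_branchTotal
  have integrable_rpow := (integrable (f := fun x => (4 : ℝ) ^ x)
    (continuous_const.rpow continuous_id fun _ => Or.inl (by norm_num))).div_const 3
  have integrable_id := (integrable (f := fun x => x) continuous_id).div_const 6
  rw [fourierCoeff_eq_intervalIntegral _ _ 0, zero_add, div_one, one_smul]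
  simp_rw [integrand_eq]
  rw [intervalIntegral.integral_sub (integrable_branchTotal.sub integrable_rpow) integrable_id,
    intervalIntegral.integral_sub integrable_branchTotal integrable_rpow,
    intervalIntegral.integral_div, intervalIntegral.integral_div, integral_fourier_mul_branchTotal,
    integral_fourier_mul_four_rpow, div_right_comm (3 : ℂ), div_self three_ne_zero]

theorem chi_div_two_ne_zero {k : ℤ} (hk : k ≠ 0) : chi k / 2 ≠ 0 := by
  intro h
  have := chi_div_two_mul_log_four k
  rw [h, zero_mul] at this
  exact mul_ne_zero Complex.two_pi_I_ne_zero (Int.cast_ne_zero.2 hk) this.symm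

theorem chi_div_two_ne_one (k : ℤ) : chi k / 2 ≠ 1 := fun h => by
  simpa [re_chi_div_two, -Complex.div_ofNat_re] using congrArg Complex.re h

theorem fourierCoeff_fluctuationCircle_of_ne {k : ℤ} (hk : k ≠ 0) :
    fourierCoeff fluctuationCircle k = deltaCoeff k := by
  have log_ne : (Real.log 2 : ℂ) ≠ 0 := Complex.ofReal_ne_zero.2 (Real.log_pos one_lt_two).ne'
  have ne_zero := chi_div_two_ne_zero hk
  have sub_one_ne := sub_ne_zero.2 (chi_div_two_ne_one k)
  rw [fourierCoeff_fluctuationCircle, integral_fourier_mul_self hk,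
    mellin_branchSumReg (by rw [re_chi_div_two]; norm_num) (by rw [re_chi_div_two]; norm_num)
      ne_zero (chi_div_two_ne_one k), ← chi_div_two_mul_log_four, deltaCoeff, log_four,
    ← neg_sub (chi k / 2) 1, mul_div_cancel₀ (chi k) two_ne_zero]
  generalize Complex.Gamma (chi k / 2) = G
  generalize riemannZeta (chi k - 1) = Z
  have chi_eq_two_mul : chi k = 2 * (chi k / 2) := by ring
  generalize chi k / 2 = s at *
  rw [chi_eq_two_mul]
  push_cast
  field_simp
  ring

/-- The mean value of `fluctuation` over a period, in closed form. -/
noncomputable def fluctuationMean : ℂ := (2 / 3 - Real.eulerMascheroniConstant / 6 -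
    4 * deriv riemannZeta (-1) - 1) / Real.log 4 - 1 / 12

theorem fourierCoeff_fluctuationCircle_zero :
    fourierCoeff fluctuationCircle 0 = fluctuationMean := by
  have chi_zero : chi 0 = 0 := by simp [chi]
  have integral_id : ∫ x in (0 : ℝ)..1, fourier (-0) (x : UnitAddCircle) * (x : ℂ) = 1 / 2 := by
    simp only [neg_zero, fourier_zero, one_mul]
    rw [intervalIntegral.integral_ofReal, integral_id]
    norm_num
  rw [fourierCoeff_fluctuationCircle, integral_id, chi_zero, zero_div, mellin_branchSumReg_zero,
    fluctuationMean]
  ring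

theorem fluctuationMean_eq_integral :
    fluctuationMean = ((∫ x in (0 : ℝ)..1, fluctuation x : ℝ) : ℂ) := by
  rw [← fourierCoeff_fluctuationCircle_zero, fourierCoeff_eq_intervalIntegral _ _ 0, zero_add,
    ← intervalIntegral.integral_ofReal]
  simp [fluctuationCircle_coe]

theorem summable_fourierCoeff_fluctuationCircle :
    Summable (fourierCoeff fluctuationCircle) := by
  obtain ⟨C, -, bound⟩ := exists_norm_deltaCoeff_le
  refine Summable.of_norm_bounded_eventually
    ((summable_abs_one_div_int_pow (p := 3) (by norm_num)).mul_left C) ?_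
  filter_upwards [(finite_singleton (0 : ℤ)).compl_mem_cofinite] with k hk
  rw [fourierCoeff_fluctuationCircle_of_ne hk]
  exact bound k hk

theorem delta_eq (x : ℝ) : delta x = (fluctuation x : ℂ) - fluctuationMean := by
  have series := has_pointwise_sum_fourier_series_of_summable
    summable_fourierCoeff_fluctuationCircle (x : UnitAddCircle)
  have split_zero := series.summable.tsum_eq_add_tsum_ite 0
  rw [series.tsum_eq, fluctuationCircle_coe, fourierCoeff_fluctuationCircle_zero, fourier_zero,
    smul_eq_mul, mul_one] at split_zero
  rw [split_zero, add_sub_cancel_left, delta]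
  refine (tsum_subtype {k : ℤ | k ≠ 0} fun k : ℤ => deltaCoeff k *
    Complex.exp (2 * Real.pi * Complex.I * k * x)).trans (tsum_congr fun k => ?_)
  by_cases hk : k = 0
  · simp [hk]
  · rw [if_neg hk, indicator_of_mem (by exact hk), fourierCoeff_fluctuationCircle_of_ne hk,
      fourier_coe_apply, smul_eq_mul, Complex.ofReal_one, div_one]

theorem continuous_delta : Continuous delta := by
  rw [funext delta_eq]
  exact (Complex.continuous_ofReal.comp continuous_fluctuation).sub continuous_const

theorem periodic_delta : Function.Periodic delta 1 := fun x => by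
  rw [delta_eq, delta_eq, periodic_fluctuation]

theorem im_delta (x : ℝ) : (delta x).im = 0 := by
  rw [delta_eq, fluctuationMean_eq_integral, ← Complex.ofReal_sub, Complex.ofReal_im]

theorem integral_delta : ∫ x in (0 : ℝ)..1, delta x = 0 := by
  simp_rw [delta_eq]
  rw [intervalIntegral.integral_sub (f := fun x => (fluctuation x : ℂ))
    ((Complex.continuous_ofReal.comp continuous_fluctuation).intervalIntegrable _ _)
    intervalIntegrable_const, intervalIntegral.integral_const, fluctuationMean_eq_integral,
    intervalIntegral.integral_ofReal, sub_zero, one_smul, sub_self]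

theorem norm_exp_int_mul_sub_le (k : ℤ) (x y : ℝ) :
    ‖Complex.exp (2 * Real.pi * Complex.I * k * x) -
      Complex.exp (2 * Real.pi * Complex.I * k * y)‖ ≤ 2 * Real.pi * |(k : ℝ)| * |x - y| := by
  have factored : Complex.exp (2 * Real.pi * Complex.I * k * x) -
      Complex.exp (2 * Real.pi * Complex.I * k * y) =
      Complex.exp (((2 * Real.pi * k * y : ℝ) : ℂ) * Complex.I) *
        (Complex.exp (Complex.I * ((2 * Real.pi * k * (x - y) : ℝ) : ℂ)) - 1) := by
    rw [mul_sub_one, ← Complex.exp_add]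
    push_cast
    ring_nf
  rw [factored, norm_mul, Complex.norm_exp_ofReal_mul_I, one_mul]
  refine Real.norm_exp_I_mul_ofReal_sub_one_le.trans_eq ?_
  rw [Real.norm_eq_abs, abs_mul, abs_mul, abs_of_pos Real.two_pi_pos]

theorem summable_deltaCoeff_mul_exp (x : ℝ) : Summable fun k : {k : ℤ // k ≠ 0} =>
    deltaCoeff k * Complex.exp (2 * Real.pi * Complex.I * (k : ℤ) * x) := by
  refine Summable.of_norm_bounded summable_norm_deltaCoeff fun k => le_of_eq ?_
  rw [norm_mul, show (2 * Real.pi * Complex.I * (k : ℤ) * x : ℂ) =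
    ((2 * Real.pi * (k : ℤ) * x : ℝ) : ℂ) * Complex.I by push_cast; ring,
    Complex.norm_exp_ofReal_mul_I, mul_one]

theorem exists_norm_delta_sub_le : ∃ K : ℝ, 0 ≤ K ∧ ∀ x y : ℝ,
    ‖delta x - delta y‖ ≤ K * |x - y| := by
  obtain ⟨C, hC, bound⟩ := exists_norm_deltaCoeff_le
  have summable_bound : Summable fun k : {k : ℤ // k ≠ 0} =>
      C * (2 * Real.pi) * |1 / ((k : ℤ) : ℝ) ^ 2| :=
    ((summable_abs_one_div_int_pow (by norm_num)).mul_left _).subtype _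
  refine ⟨∑' k : {k : ℤ // k ≠ 0}, C * (2 * Real.pi) * |1 / ((k : ℤ) : ℝ) ^ 2|,
    tsum_nonneg fun k => by positivity, fun x y => ?_⟩
  rw [delta, delta, ← (summable_deltaCoeff_mul_exp x).tsum_sub (summable_deltaCoeff_mul_exp y),
    ← tsum_mul_right]
  refine tsum_of_norm_bounded (summable_bound.mul_right _).hasSum fun k => ?_
  have abs_ne : |((k : ℤ) : ℝ)| ≠ 0 := abs_ne_zero.2 (Int.cast_ne_zero.2 k.2)
  rw [← mul_sub, norm_mul]
  calc _ ≤ C * |1 / ((k : ℤ) : ℝ) ^ 3| * (2 * Real.pi * |((k : ℤ) : ℝ)| * |x - y|) := by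
        gcongr
        exacts [bound k k.2, norm_exp_int_mul_sub_le k x y]
    _ = _ := by
        rw [abs_div, abs_div, abs_one, abs_pow, abs_pow]
        field_simp

/-! ### Asymptotics of the expected number of branches -/

/-- The sum `∑_{k ≥ 1} k (2 v + v² / 3 - 2 v³ / 3) e^{-v}` with `v = k² t`, which is the
coefficient of `1 / M` when `branchWeight` is replaced by its Gaussian approximation. -/
noncomputable def correctionSum (t : ℝ) : ℝ :=
  2 * expSum 1 t + 1 / 3 * expSum 2 t - 2 / 3 * expSum 3 t

theorem exists_abs_correctionSum_le :
    ∃ C : ℝ, 0 ≤ C ∧ ∀ t : ℝ, 0 < t → |correctionSum t| ≤ C / t ^ 2 := by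
  obtain ⟨C₁, hC₁, bound₁⟩ := exists_expSum_le_div_sq 1
  obtain ⟨C₂, hC₂, bound₂⟩ := exists_expSum_le_div_sq 2
  obtain ⟨C₃, hC₃, bound₃⟩ := exists_expSum_le_div_sq 3
  refine ⟨2 * C₁ + 1 / 3 * C₂ + 2 / 3 * C₃, by positivity, fun t ht => ?_⟩
  rw [correctionSum, abs_le, add_div, add_div, mul_div_assoc, mul_div_assoc, mul_div_assoc]
  constructor <;>
    linarith [bound₁ t ht, bound₂ t ht, bound₃ t ht, expSum_nonneg 1 ht, expSum_nonneg 2 ht,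
      expSum_nonneg 3 ht]

theorem exists_abs_correctionSum_add_le_mul : ∃ C : ℝ, 0 ≤ C ∧ ∀ t : ℝ, 0 < t →
    |correctionSum t + 2 / 3 / t| ≤ C * t := by
  obtain ⟨C₁, hC₁, bound₁⟩ := exists_abs_expSum_sub_le 1
  obtain ⟨C₂, hC₂, bound₂⟩ := exists_abs_expSum_sub_le 2
  obtain ⟨C₃, hC₃, bound₃⟩ := exists_abs_expSum_sub_le 3
  refine ⟨2 * C₁ + 1 / 3 * C₂ + 2 / 3 * C₃, by positivity, fun t ht => ?_⟩
  have bound₁ := abs_le.1 (bound₁ t ht)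
  have bound₂ := abs_le.1 (bound₂ t ht)
  have bound₃ := abs_le.1 (bound₃ t ht)
  norm_num [Nat.factorial] at bound₁ bound₂ bound₃
  have split : correctionSum t + 2 / 3 / t = 2 * (expSum 1 t - 1 / 2 / t) +
      1 / 3 * (expSum 2 t - 1 / t) - 2 / 3 * (expSum 3 t - 3 / t) := by
    rw [correctionSum]
    ring
  rw [split, abs_le]
  norm_num at bound₁ bound₂ bound₃ ⊢
  constructor <;> linarith

theorem exists_abs_correctionSum_add_le_div : ∃ C : ℝ, 0 ≤ C ∧ ∀ t : ℝ, 0 < t →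
    |correctionSum t + 2 / 3 / t| ≤ C / t := by
  obtain ⟨C₁, hC₁, bound₁⟩ := exists_expSum_le_div 1
  obtain ⟨C₂, hC₂, bound₂⟩ := exists_expSum_le_div 2
  obtain ⟨C₃, hC₃, bound₃⟩ := exists_expSum_le_div 3
  refine ⟨2 * C₁ + 1 / 3 * C₂ + 2 / 3 * C₃ + 2 / 3, by positivity, fun t ht => ?_⟩
  have pole_nonneg : 0 ≤ 2 / 3 / t := by positivity
  rw [correctionSum, abs_le, add_div, add_div, add_div, mul_div_assoc, mul_div_assoc,
    mul_div_assoc]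
  constructor <;>
    linarith [bound₁ t ht, bound₂ t ht, bound₃ t ht, expSum_nonneg 1 ht, expSum_nonneg 2 ht,
      expSum_nonneg 3 ht]

theorem exists_abs_correctionSum_four_rpow_add_le : ∃ C : ℝ, 0 ≤ C ∧ ∀ (r : ℤ) (x : ℝ),
    |correctionSum ((4 : ℝ) ^ (r - x)) + 2 / 3 / (4 : ℝ) ^ (r - x)| ≤
      C * (1 / 4 : ℝ) ^ (r - ⌊x⌋).natAbs := by
  obtain ⟨C, hC, bound_mul⟩ := exists_abs_correctionSum_add_le_mul
  obtain ⟨D, hD, bound_div⟩ := exists_abs_correctionSum_add_le_div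
  refine ⟨4 * (C + D), by positivity, fun r x => ?_⟩
  have floor_le := Int.floor_le x
  have lt_floor := Int.lt_floor_add_one x
  rw [quarter_pow_natAbs, mul_right_comm, mul_comm (4 : ℝ), ← Real.rpow_add_one (by norm_num),
    mul_comm _ (C + D), Int.cast_sub]
  rcases le_or_gt r ⌊x⌋ with hr | hr
  · have hr' : (r : ℝ) ≤ ⌊x⌋ := by exact_mod_cast hr
    refine (bound_mul _ (by positivity)).trans ?_
    rw [abs_of_nonpos (by linarith)]
    gcongr <;> linarith
  · have hr' : (⌊x⌋ : ℝ) + 1 ≤ r := by exact_mod_cast hr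
    refine (bound_div _ (by positivity)).trans ?_
    rw [div_eq_mul_inv, ← Real.rpow_neg (by norm_num), abs_of_nonneg (by linarith)]
    gcongr <;> linarith

theorem summable_quarter_pow_natAbs_sub (a : ℤ) :
    Summable fun r : ℤ => (1 / 4 : ℝ) ^ (r - a).natAbs :=
  summable_quarter_pow_natAbs.comp_injective (Equiv.subRight a).injective

theorem summable_quarter_pow_natAbs_natCast_sub (a : ℤ) :
    Summable fun r : ℕ => (1 / 4 : ℝ) ^ ((r : ℤ) - a).natAbs :=
  (summable_quarter_pow_natAbs_sub a).comp_injective Nat.cast_injective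

theorem tsum_quarter_pow_natAbs_natCast_sub_le (a : ℤ) :
    ∑' r : ℕ, (1 / 4 : ℝ) ^ ((r : ℤ) - a).natAbs ≤ ∑' r : ℤ, (1 / 4 : ℝ) ^ r.natAbs :=
  calc ∑' r : ℕ, (1 / 4 : ℝ) ^ ((r : ℤ) - a).natAbs
      ≤ ∑' r : ℤ, (1 / 4 : ℝ) ^ (r - a).natAbs :=
        tsum_comp_le_tsum_of_inj (summable_quarter_pow_natAbs_sub a)
          (fun _ => by positivity) Nat.cast_injective
    _ = ∑' r : ℤ, (1 / 4 : ℝ) ^ r.natAbs :=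
        (Equiv.subRight a).tsum_eq fun r : ℤ => (1 / 4 : ℝ) ^ r.natAbs

theorem hasSum_geometric_quarter (c : ℝ) :
    HasSum (fun r : ℕ => c / (4 : ℝ) ^ r) (c * (4 / 3)) := by
  have geometric :=
    (hasSum_geometric_of_lt_one (r := (1 / 4 : ℝ)) (by norm_num) (by norm_num)).mul_left c
  norm_num at geometric
  simpa only [div_eq_mul_inv, inv_pow, one_mul] using geometric

theorem summable_of_abs_le_div_sq {f : ℝ → ℝ} {C : ℝ}
    (bound : ∀ t : ℝ, 0 < t → |f t| ≤ C / t ^ 2) {M : ℝ} (hM : 0 < M) :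
    Summable fun r : ℕ => f ((4 : ℝ) ^ r / M) := by
  have hC : 0 ≤ C := by simpa using (abs_nonneg _).trans (bound 1 one_pos)
  refine Summable.of_norm_bounded (hasSum_geometric_quarter (C * M ^ 2)).summable fun r => ?_
  refine (bound _ (by positivity)).trans ?_
  rw [div_pow, div_div_eq_mul_div]
  gcongr
  exact le_self_pow₀ (one_le_pow₀ (by norm_num)) two_ne_zero

theorem summable_branchSum {M : ℝ} (hM : 0 < M) :
    Summable fun r : ℕ => branchSum ((4 : ℝ) ^ r / M) :=
  let ⟨_, _, bound⟩ := exists_abs_branchSum_le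
  summable_of_abs_le_div_sq bound hM

theorem summable_correctionSum {M : ℝ} (hM : 0 < M) :
    Summable fun r : ℕ => correctionSum ((4 : ℝ) ^ r / M) :=
  let ⟨_, _, bound⟩ := exists_abs_correctionSum_le
  summable_of_abs_le_div_sq bound hM

theorem norm_tsum_sub_le_of_norm_sub_le {ι E : Type*} [NormedAddCommGroup E] [CompleteSpace E]
    {f g : ι → E} {b : ι → ℝ} {s : E} {B : ℝ} (hg : HasSum g s) (hb : HasSum b B)
    (bound : ∀ i, ‖f i - g i‖ ≤ b i) : ‖∑' i, f i - s‖ ≤ B := by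
  have summable_f := (Summable.of_norm_bounded hb.summable bound).add hg.summable
  simp only [sub_add_cancel] at summable_f
  rw [← hg.tsum_eq, ← summable_f.tsum_sub hg.summable]
  exact tsum_of_norm_bounded hb bound

theorem hasSum_branchSum_add_correctionSum {t : ℝ} (ht : 0 < t) (M : ℝ) :
    HasSum (fun k : ℕ => ((k : ℝ) + 1) * (((4 * (((k : ℝ) + 1) ^ 2 * t) - 2) +
        (2 * (((k : ℝ) + 1) ^ 2 * t) + (((k : ℝ) + 1) ^ 2 * t) ^ 2 / 3 -
          2 / 3 * (((k : ℝ) + 1) ^ 2 * t) ^ 3) / M) * Real.exp (-(((k : ℝ) + 1) ^ 2 * t))))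
      (branchSum t + correctionSum t / M) := by
  have hasSum_expSum (j : ℕ) := (summable_expSum j ht).hasSum
  refine (((hasSum_expSum 1).mul_left 4).sub ((hasSum_expSum 0).mul_left 2)).add
    ((((hasSum_expSum 1).mul_left 2).add ((hasSum_expSum 2).mul_left (1 / 3))).sub
      ((hasSum_expSum 3).mul_left (2 / 3)) |>.div_const M) |>.congr_fun fun k => ?_
  ring

theorem exists_abs_tsum_branchWeight_sub_le : ∃ C : ℝ, 0 ≤ C ∧ ∀ N : ℕ, 0 < N → ∀ M : ℝ,
    M = N + 1 / 2 → ∀ r : ℕ, |∑' k : ℕ, ((k : ℝ) + 1) * branchWeight N ((k + 1) * 2 ^ r) -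
      (branchSum ((4 : ℝ) ^ r / M) + correctionSum ((4 : ℝ) ^ r / M) / M)| ≤
        C / M / (4 : ℝ) ^ r := by
  obtain ⟨C, hC, bound⟩ := exists_abs_branchWeight_sub_le
  obtain ⟨D₀, hD₀, bound₀⟩ := exists_expSum_le_div 0
  obtain ⟨D₅, hD₅, bound₅⟩ := exists_expSum_le_div 5
  refine ⟨C * (D₀ + D₅), by positivity, fun N hN M hM r => ?_⟩
  have hM0 : 0 < M := by rw [hM]; positivity
  have ht : 0 < (4 : ℝ) ^ r / M := by positivity
  have scale_eq (k : ℕ) :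
      ((k : ℝ) + 1) ^ 2 * ((4 : ℝ) ^ r / M) = (((k + 1) * 2 ^ r : ℕ) : ℝ) ^ 2 / M := by
    push_cast
    rw [mul_pow, ← pow_mul, mul_comm r 2, pow_mul, mul_div_assoc]
    norm_num
  have hasSum_error := ((summable_expSum 0 ht).hasSum.add (summable_expSum 5 ht).hasSum).mul_left
    (C / M ^ 2)
  have error_le := norm_tsum_sub_le_of_norm_sub_le
    (f := fun k : ℕ => ((k : ℝ) + 1) * branchWeight N ((k + 1) * 2 ^ r))
    (hasSum_branchSum_add_correctionSum ht M) hasSum_error fun k => ?_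
  · refine error_le.trans ?_
    calc C / M ^ 2 * (expSum 0 ((4 : ℝ) ^ r / M) + expSum 5 ((4 : ℝ) ^ r / M))
        ≤ C / M ^ 2 * (D₀ / ((4 : ℝ) ^ r / M) + D₅ / ((4 : ℝ) ^ r / M)) := by
          gcongr
          exacts [bound₀ _ ht, bound₅ _ ht]
      _ = C * (D₀ + D₅) / M / (4 : ℝ) ^ r := by field_simp
  · have hk : (0 : ℝ) ≤ (k : ℝ) + 1 := by positivity
    rw [← mul_sub, Real.norm_eq_abs, abs_mul, abs_of_nonneg hk]
    refine (mul_le_mul_of_nonneg_left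
      (bound N ((k + 1) * 2 ^ r) hN M _ hM (scale_eq k)) hk).trans_eq ?_
    ring

theorem exists_abs_expectedBranches_sub_tsum_le : ∃ C : ℝ, 0 ≤ C ∧ ∀ (n : ℕ) (M : ℝ),
    M = (n + 1 : ℕ) + 1 / 2 → |expectedBranches n -
      (∑' r : ℕ, branchSum ((4 : ℝ) ^ r / M) + (∑' r : ℕ, correctionSum ((4 : ℝ) ^ r / M)) / M)| ≤
      C / M := by
  obtain ⟨C, hC, bound⟩ := exists_abs_tsum_branchWeight_sub_le
  refine ⟨C * (4 / 3), by positivity, fun n M hM => ?_⟩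
  have hM0 : 0 < M := by rw [hM]; positivity
  rw [expectedBranches_eq_tsum, ← Real.norm_eq_abs]
  refine (norm_tsum_sub_le_of_norm_sub_le
    ((summable_branchSum hM0).hasSum.add ((summable_correctionSum hM0).hasSum.div_const M))
    (hasSum_geometric_quarter (C / M)) (bound (n + 1) n.succ_pos M hM)).trans_eq ?_
  ring

theorem four_rpow_sub_logb {M : ℝ} (hM : 0 < M) (r : ℝ) :
    (4 : ℝ) ^ (r - Real.logb 4 M) = (4 : ℝ) ^ r / M := by
  rw [Real.rpow_sub (by norm_num), Real.rpow_logb (by norm_num) (by norm_num) hM]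

theorem tsum_branchTerm_natCast {M : ℝ} (hM : 0 < M) :
    ∑' r : ℕ, branchTerm r (Real.logb 4 M) =
      ∑' r : ℕ, branchSum ((4 : ℝ) ^ r / M) - (M + 1 / 6) := by
  have branchTerm_eq (r : ℕ) : branchTerm r (Real.logb 4 M) =
      branchSum ((4 : ℝ) ^ r / M) - if r = 0 then M + 1 / 6 else 0 := by
    rw [branchTerm, Int.cast_natCast, four_rpow_sub_logb hM, Real.rpow_natCast]
    rcases r.eq_zero_or_pos with rfl | hr
    · simp [Real.rpow_logb, hM]
    · rw [if_neg (by omega), if_neg hr.ne']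
  simp_rw [branchTerm_eq]
  rw [(summable_branchSum hM).tsum_sub (summable_of_ne_finset_zero (s := {0}) fun r hr =>
    if_neg (Finset.notMem_singleton.1 hr)), tsum_ite_eq]

theorem exists_abs_branchTerm_neg_le : ∃ C : ℝ, 0 ≤ C ∧ ∀ M : ℝ, 0 < M → ∀ r : ℕ,
    |branchTerm (-((r : ℤ) + 1)) (Real.logb 4 M)| ≤ C / M / (4 : ℝ) ^ r := by
  obtain ⟨C, hC, bound⟩ := exists_abs_branchTerm_le_of_nonpos
  refine ⟨C, hC, fun M hM r => (bound _ (by omega) _).trans ?_⟩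
  rw [four_rpow_sub_logb hM, div_div, div_eq_mul_inv C, mul_inv, ← Real.rpow_natCast,
    ← Real.rpow_neg (by norm_num), mul_comm M⁻¹, ← div_eq_mul_inv]
  gcongr
  · norm_num
  · push_cast
    linarith

theorem exists_abs_tsum_branchSum_sub_le : ∃ C : ℝ, 0 ≤ C ∧ ∀ M : ℝ, 0 < M →
    |∑' r : ℕ, branchSum ((4 : ℝ) ^ r / M) - (4 / 3 * M + Real.logb 4 M / 6 +
      fluctuation (Real.logb 4 M) + 1 / 6)| ≤ C / M := by
  obtain ⟨C, hC, bound⟩ := exists_abs_branchTerm_neg_le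
  refine ⟨C * (4 / 3), by positivity, fun M hM => ?_⟩
  have geometric := hasSum_geometric_quarter (C / M)
  have branchTotal_eq : branchTotal (Real.logb 4 M) = ∑' r : ℕ, branchTerm r (Real.logb 4 M) +
      ∑' r : ℕ, branchTerm (-((r : ℤ) + 1)) (Real.logb 4 M) :=
    tsum_of_nat_of_neg_add_one ((summable_branchTerm _).comp_injective Nat.cast_injective)
      (Summable.of_norm_bounded geometric.summable (bound M hM))
  have difference_eq : ∑' r : ℕ, branchSum ((4 : ℝ) ^ r / M) - (4 / 3 * M + Real.logb 4 M / 6 +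
      fluctuation (Real.logb 4 M) + 1 / 6) =
      -∑' r : ℕ, branchTerm (-((r : ℤ) + 1)) (Real.logb 4 M) := by
    rw [fluctuation, branchTotal_eq, tsum_branchTerm_natCast hM,
      Real.rpow_logb (by norm_num) (by norm_num) hM]
    ring
  rw [difference_eq, abs_neg, ← Real.norm_eq_abs]
  refine (tsum_of_norm_bounded geometric (bound M hM)).trans_eq ?_
  ring

theorem exists_abs_tsum_correctionSum_add_le : ∃ C : ℝ, 0 ≤ C ∧ ∀ M : ℝ, 0 < M →
    |(∑' r : ℕ, correctionSum ((4 : ℝ) ^ r / M)) / M + 8 / 9| ≤ C / M := by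
  obtain ⟨C, hC, bound⟩ := exists_abs_correctionSum_four_rpow_add_le
  refine ⟨C * ∑' r : ℤ, (1 / 4 : ℝ) ^ r.natAbs,
    mul_nonneg hC (tsum_nonneg fun r => by positivity), fun M hM => ?_⟩
  have hasSum_pole : HasSum (fun r : ℕ => 2 / 3 / ((4 : ℝ) ^ r / M)) (8 / 9 * M) := by
    convert hasSum_geometric_quarter (2 / 3 * M) using 1
    · funext r
      field_simp
    · ring
  have error_le : ‖∑' r : ℕ, correctionSum ((4 : ℝ) ^ r / M) - -(8 / 9 * M)‖ ≤
      C * ∑' r : ℕ, (1 / 4 : ℝ) ^ ((r : ℤ) - ⌊Real.logb 4 M⌋).natAbs := by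
    refine norm_tsum_sub_le_of_norm_sub_le hasSum_pole.neg
      ((summable_quarter_pow_natAbs_natCast_sub _).hasSum.mul_left C) fun r => ?_
    have bound_r := bound r (Real.logb 4 M)
    rwa [four_rpow_sub_logb hM, Int.cast_natCast, Real.rpow_natCast, ← sub_neg_eq_add] at bound_r
  rw [sub_neg_eq_add, Real.norm_eq_abs] at error_le
  calc |(∑' r : ℕ, correctionSum ((4 : ℝ) ^ r / M)) / M + 8 / 9|
      = |∑' r : ℕ, correctionSum ((4 : ℝ) ^ r / M) + 8 / 9 * M| / M := by
        rw [← abs_of_pos hM, ← abs_div, abs_of_pos hM, add_div, mul_div_cancel_right₀ _ hM.ne']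
    _ ≤ (C * ∑' r : ℤ, (1 / 4 : ℝ) ^ r.natAbs) / M := by
        gcongr
        exact error_le.trans (by gcongr; exact tsum_quarter_pow_natAbs_natCast_sub_le _)

/-- The expansion of the expected number of branches up to an additive constant, as a function of
a continuous size parameter `u`. The method of proof provides the expansion at `u = n + 3 / 2`
rather than at the size `u = n`. -/
noncomputable def branchExpansion (u : ℝ) : ℂ :=
  4 / 3 * u + Real.logb 4 u / 6 + fluctuationMean + delta (Real.logb 4 u)

theorem exists_norm_expectedBranches_sub_le : ∃ C : ℝ, 0 ≤ C ∧ ∀ (n : ℕ) (M : ℝ),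
    M = (n + 1 : ℕ) + 1 / 2 →
    ‖(expectedBranches n : ℂ) - (branchExpansion M - 13 / 18)‖ ≤ C / M := by
  obtain ⟨C₁, hC₁, bound_expectedBranches⟩ := exists_abs_expectedBranches_sub_tsum_le
  obtain ⟨C₂, hC₂, bound_branchSum⟩ := exists_abs_tsum_branchSum_sub_le
  obtain ⟨C₃, hC₃, bound_correctionSum⟩ := exists_abs_tsum_correctionSum_add_le
  refine ⟨C₁ + C₂ + C₃, by positivity, fun n M hM => ?_⟩
  have hM0 : 0 < M := by rw [hM]; positivity
  have branchExpansion_eq : branchExpansion M - 13 / 18 = ((4 / 3 * M + Real.logb 4 M / 6 +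
      fluctuation (Real.logb 4 M) + 1 / 6 - 8 / 9 : ℝ) : ℂ) := by
    rw [branchExpansion, delta_eq]
    push_cast
    ring
  have bound₁ := abs_le.1 (bound_expectedBranches n M hM)
  have bound₂ := abs_le.1 (bound_branchSum M hM0)
  have bound₃ := abs_le.1 (bound_correctionSum M hM0)
  rw [branchExpansion_eq, ← Complex.ofReal_sub, Complex.norm_real, Real.norm_eq_abs, abs_le,
    add_div, add_div]
  constructor <;> linarith

theorem abs_logb_four_sub_le {n : ℕ} (hn : 0 < n) :
    |Real.logb 4 ((n + 1 : ℕ) + 1 / 2) - Real.logb 4 n| ≤ 3 / 2 / n := by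
  have hn' : (0 : ℝ) < n := by exact_mod_cast hn
  have one_le_log_four : 1 ≤ Real.log 4 := by
    rw [log_four]
    linarith [Real.log_two_gt_d9]
  have hpos : 0 < 3 / 2 / (n : ℝ) := by positivity
  have log_nonneg : 0 ≤ Real.log (1 + 3 / 2 / n) := Real.log_nonneg (by linarith)
  have log_le : Real.log (1 + 3 / 2 / n) ≤ 3 / 2 / n := by
    linarith [Real.log_le_sub_one_of_pos (show 0 < 1 + 3 / 2 / (n : ℝ) by positivity)]
  have ratio_eq : (((n + 1 : ℕ) : ℝ) + 1 / 2) / n = 1 + 3 / 2 / n := by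
    push_cast
    field_simp
    ring
  rw [Real.logb, Real.logb, ← sub_div, ← Real.log_div (by positivity) hn'.ne', ratio_eq,
    abs_of_nonneg (by positivity)]
  exact (div_le_self log_nonneg one_le_log_four).trans log_le

theorem exists_norm_branchExpansion_sub_le : ∃ C : ℝ, 0 ≤ C ∧ ∀ n : ℕ, 0 < n →
    ‖branchExpansion ((n + 1 : ℕ) + 1 / 2 : ℝ) - (branchExpansion n + 2)‖ ≤ C / n := by
  obtain ⟨K, hK, lipschitz⟩ := exists_norm_delta_sub_le
  refine ⟨(1 / 6 + K) * (3 / 2), by positivity, fun n hn => ?_⟩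
  set M : ℝ := (n + 1 : ℕ) + 1 / 2 with hM
  have difference_eq : branchExpansion M - (branchExpansion n + 2) =
      ((1 / 6 * (Real.logb 4 M - Real.logb 4 n) : ℝ) : ℂ) +
        (delta (Real.logb 4 M) - delta (Real.logb 4 n)) := by
    rw [branchExpansion, branchExpansion]
    push_cast [hM]
    ring
  rw [difference_eq]
  calc _ ≤ 1 / 6 * |Real.logb 4 M - Real.logb 4 n| + K * |Real.logb 4 M - Real.logb 4 n| := by
        refine (norm_add_le _ _).trans (add_le_add (le_of_eq ?_) (lipschitz _ _))
        rw [Complex.norm_real, Real.norm_eq_abs, abs_mul, abs_of_pos (by norm_num)]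
    _ = (1 / 6 + K) * |Real.logb 4 M - Real.logb 4 n| := by ring
    _ ≤ (1 / 6 + K) * (3 / 2 / n) := by
        gcongr
        exact abs_logb_four_sub_le hn
    _ = _ := by ring

theorem branchExpansion_natCast (n : ℕ) :
    branchExpansion n + 23 / 18 = 4 * (n : ℂ) / 3 + 1 / 6 * (Real.logb 4 n : ℂ)
      - 2 * deriv riemannZeta (-1) / (Real.log 2 : ℂ)
      - (Real.eulerMascheroniConstant : ℂ) / (12 * (Real.log 2 : ℂ))
      - 1 / (6 * (Real.log 2 : ℂ)) + 43 / 36 + delta (Real.logb 4 n) := by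
  have log_ne : (Real.log 2 : ℂ) ≠ 0 := Complex.ofReal_ne_zero.2 (Real.log_pos one_lt_two).ne'
  rw [branchExpansion, fluctuationMean, log_four]
  push_cast
  field_simp
  ring

theorem isBigO_expectedBranches_sub_branchExpansion :
    (fun n : ℕ => (expectedBranches n : ℂ) - (branchExpansion n + 23 / 18))
      =O[atTop] fun n : ℕ => 1 / (n : ℝ) := by
  obtain ⟨C, hC, bound_expectedBranches⟩ := exists_norm_expectedBranches_sub_le
  obtain ⟨D, -, bound_branchExpansion⟩ := exists_norm_branchExpansion_sub_le
  refine Asymptotics.IsBigO.of_bound (C + D) ?_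
  filter_upwards [eventually_gt_atTop 0] with n hn
  have : (0 : ℝ) < n := by exact_mod_cast hn
  set M : ℝ := (n + 1 : ℕ) + 1 / 2 with hM
  have le_M : (n : ℝ) ≤ M := by
    push_cast [hM]
    linarith
  calc ‖(expectedBranches n : ℂ) - (branchExpansion n + 23 / 18)‖
      = ‖((expectedBranches n : ℂ) - (branchExpansion M - 13 / 18)) +
          (branchExpansion M - (branchExpansion n + 2))‖ := by
        congr 1
        ring
    _ ≤ C / M + D / n :=
        (norm_add_le _ _).trans
          (add_le_add (bound_expectedBranches n M hM) (bound_branchExpansion n hn))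
    _ ≤ C / n + D / n := by gcongr
    _ = (C + D) * ‖1 / (n : ℝ)‖ := by
        rw [Real.norm_of_nonneg (by positivity)]
        ring

theorem isBigO_one_div_log_div :
    (fun n : ℕ => 1 / (n : ℝ)) =O[atTop] fun n : ℕ => Real.log n / n := by
  refine Asymptotics.IsBigO.of_bound 1 ?_
  filter_upwards [eventually_ge_atTop 3] with n hn
  have hn' : (3 : ℝ) ≤ n := by exact_mod_cast hn
  have one_le_log : 1 ≤ Real.log n := by
    rw [Real.le_log_iff_exp_le (by linarith)]
    linarith [Real.exp_one_lt_d9]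
  rw [one_mul, Real.norm_of_nonneg (by positivity), Real.norm_of_nonneg (by positivity)]
  gcongr

end TreeBranches

theorem mainTheorem1 :
    Summable (fun k : {k : ℤ // k ≠ 0} => ‖TreeBranches.deltaCoeff k‖) ∧
    Continuous TreeBranches.delta ∧
    (∀ x : ℝ, (TreeBranches.delta x).im = 0) ∧
    Function.Periodic TreeBranches.delta 1 ∧
    (∫ x in (0 : ℝ)..1, TreeBranches.delta x) = 0 ∧
    (fun n : ℕ => (TreeBranches.expectedBranches n : ℂ) -
        (4 * (n : ℂ) / 3 + 1 / 6 * (Real.logb 4 n : ℂ)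
          - 2 * deriv riemannZeta (-1) / (Real.log 2 : ℂ)
          - (Real.eulerMascheroniConstant : ℂ) / (12 * (Real.log 2 : ℂ))
          - 1 / (6 * (Real.log 2 : ℂ)) + 43 / 36
          + TreeBranches.delta (Real.logb 4 n)))
      =O[Filter.atTop] (fun n : ℕ => Real.log n / n) := by
  refine ⟨TreeBranches.summable_norm_deltaCoeff, TreeBranches.continuous_delta,
    TreeBranches.im_delta, TreeBranches.periodic_delta, TreeBranches.integral_delta, ?_⟩
  simp_rw [← TreeBranches.branchExpansion_natCast]
  exact TreeBranches.isBigO_expectedBranches_sub_branchExpansion.trans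
    TreeBranches.isBigO_one_div_log_div
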